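/- Let $(S_n)_{n\ge 0}$ be simple random walk on $\mathbb{Z}^2$, $P_x$ its law when started from $x$, and $x\sim y$ the nearest-neighbour relation. For $A\subset\mathbb{Z}^2$ let $\tau_1(A)=\inf\{k\ge 1: S_k\in A\}$ ($\inf\emptyset=\infty$). Let $$a(x)=\sum_{k=0}^{\infty}\bigl(P_0[S_k=0]-P_x[S_k=0]\bigr)=\lim_{n\to\infty}\sum_{k<n}\bigl(P_0[S_k=0]-P_x[S_k=0]\bigr)$$ be the potential kernel, let $\mathrm{hm}_A(x)=\lim_{\|y\|\to\infty}P_y[S_{\tau_1(A)}=x]$ be the harmonic measure of a finite set $A$, and, for finite $A\ni 0$, let $\mathrm{cap}(A)=\sum_{x\in A}a(x)\,\mathrm{hm}_A(x)$. Let $\widehat S$ be the Markov chain on $\mathbb{Z}^2\setminus\{0\}$ with transition probability $\frac{a(y)}{4a(x)}$ from $x$ to each $y\sim x$ (the Doob $h$-transform of $S$ with $h=a$), let $\widehat P_x$ be its law when started from $x\neq 0$, and let $\widehat\tau_1(A)$ be its hitting time defined as above. For finite $A\subset\mathbb{Z}^2$ put $\widehat e_A(x)=\mathbf 1\{x\in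 A\}\,\widehat P_x[\widehat\tau_1(A)=\infty]\,a(x)^2$ (which is $0$ for $x=0$) and $\widehat{\mathrm{cap}}(A)=\sum_{x\in A}\widehat e_A(x)$. Let $W$ be the space of doubly infinite nearest-neighbour trajectories $\varrho:\mathbb{Z}\to\mathbb{Z}^2$ that visit every site finitely often, with its cylindrical $\sigma$-field. Let $\chi^*:W\to W^*$ be the projection onto trajectories modulo time shift, where $W^*$ carries the $\sigma$-field of the sets whose preimage under $\chi^*$ is measurable. Let $W^*_A\subset W^*$ be the set of classes of trajectories that intersect $A$. For finite $A$ let $Q_A$ be the finite measure on $W$ with $$Q_A\bigl[(\varrho_k)_{k\ge 1}\in F,\ \varrho_0=x,\ (\varrho_{-k})_{k\ge 1}\in G\bigr]=\widehat e_A(x)\,\widehat P_x\bigl[(\widehat S_k)_{k\ge 1}\in F\bigr]\,\widehat P_x\bigl[(\widehat S_k)_{k\ge 1}\in G\mid\widehat\tau_1(A)=\infty\bigr],$$ read as $0$ when $\widehat e_A(x)=0$. Let $\nu$ be the $\sigma$-finite measure on $W^*$ such that $\mathbf 1_{W^*_A}\cdot\nu=Q_A\circ(\chi^*)^{-1}$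 for every finite $A\subset\mathbb{Z}^2$. Given a Poisson point process $\sum_\lambda\delta_{(w^*_\lambda,u_\lambda)}$ on $W^*\times\mathbb{R}_+$ with intensity measure $\nu\otimes du$, defined on a probability space with probability $\mathbb{P}$, let, for $\alpha>0$, the vacant set $\mathcal V^\alpha$ be the set of sites of $\mathbb{Z}^2$ that are visited by no trajectory $w^*_\lambda$ with $u_\lambda\le\pi\alpha$. **Proposition.** These objects are well defined: the series for $a$ converges for every $x$; $a(x)>0$ for $x\ne 0$; for $x\neq 0$ the numbers $\frac{a(y)}{4a(x)}$, $y\sim x$, form a probability distribution; for every finite $A\ni 0$ the limit that defines $\mathrm{hm}_A(x)$ exists for every $x$; and the measure $\nu$ exists and is unique. For every finite $A\subset\mathbb{Z}^2$ with $0\in A$, $$\mathrm{cap}(A)=\widehat{\mathrm{cap}}(A),$$ and hence, for every $\alpha>0$, $$\mathbb{P}[A\subset\mathcal V^\alpha]=\exp\bigl(-\pi\alpha\,\mathrm{cap}(A)\bigr).$$ -/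

import Mathlib

open MeasureTheory ProbabilityTheory Filter Topology
open scoped NNReal ENNReal

namespace RI2D

/-- The planar lattice `ℤ²`. -/
abbrev Z2 : Type := ℤ × ℤ

/-- The four nearest neighbours of a site. -/
def nbrs (x : Z2) : Finset Z2 :=
  {x + (1, 0), x + (-1, 0), x + (0, 1), x + (0, -1)}

lemma nbrs_nonempty (x : Z2) : (nbrs x).Nonempty := ⟨x + (1, 0), by simp [nbrs]⟩

/-- The Markov kernel with one-step transition probabilities `p`. -/
noncomputable def stepKernel (p : Z2 → PMF Z2) : Kernel Z2 Z2 :=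
  Kernel.ofFunOfCountable fun y => (p y).toMeasure

instance (p : Z2 → PMF Z2) : IsMarkovKernel (stepKernel p) :=
  ⟨fun y => inferInstanceAs (IsProbabilityMeasure (p y).toMeasure)⟩

/-- The law on path space `ℕ → ℤ²` of the time-homogeneous Markov chain that starts at `x` and
whose one-step transition probabilities from `y` are given by `p y`. -/
noncomputable def chainLaw (p : Z2 → PMF Z2) (x : Z2) : Measure (ℕ → Z2) :=
  Kernel.trajMeasure (X := fun _ : ℕ => Z2) (Measure.dirac x) fun n =>
    (stepKernel p).comap (fun h : ((i : Finset.Iic n) → Z2) => h ⟨n, Finset.mem_Iic.2 le_rfl⟩)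
      (measurable_pi_apply _)

/-- The law `P_x` of simple random walk started from `x`. -/
noncomputable def srw (x : Z2) : Measure (ℕ → Z2) :=
  chainLaw (fun y => PMF.uniformOfFinset (nbrs y) (nbrs_nonempty y)) x

/-- The hitting time `τ₁(A) = inf {k ≥ 1 : S_k ∈ A}`, with `inf ∅ = ∞`. -/
noncomputable def hitTime (A : Set Z2) (ω : ℕ → Z2) : ℕ∞ :=
  ⨅ (k : ℕ) (_ : 1 ≤ k ∧ ω k ∈ A), (k : ℕ∞)

/-- Partial sums of the series that defines the potential kernel. -/
noncomputable def potentialPartialSum (x : Z2) (n : ℕ) : ℝ :=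
  ∑ k ∈ Finset.range n, ((srw 0).real {ω | ω k = 0} - (srw x).real {ω | ω k = 0})

/-- The potential kernel `a(x) = ∑_{k ≥ 0} (P_0[S_k = 0] - P_x[S_k = 0])`. The series is in general
only conditionally convergent, so its sum is the limit of the partial sums. -/
noncomputable def potentialKernel (x : Z2) : ℝ :=
  limUnder atTop (potentialPartialSum x)

/-- The probability `P_y[S_{τ₁(A)} = x]` (the event includes `τ₁(A) < ∞`). -/
noncomputable def hitProb (A : Finset Z2) (y x : Z2) : ℝ :=
  (srw y).real {ω | ∃ k : ℕ, hitTime A ω = k ∧ ω k = x}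

/-- The harmonic measure `hm_A(x) = lim_{‖y‖ → ∞} P_y[S_{τ₁(A)} = x]`. -/
noncomputable def harmonicMeasure (A : Finset Z2) (x : Z2) : ℝ :=
  limUnder (Bornology.cobounded Z2) fun y => hitProb A y x

/-- The two-dimensional capacity `cap(A) = ∑_{x ∈ A} a(x) hm_A(x)` of a finite set `A` that
contains the origin. -/
noncomputable def capacity (A : Finset Z2) : ℝ :=
  ∑ x ∈ A, potentialKernel x * harmonicMeasure A x

open Classical in
/-- One step of the conditioned walk `Ŝ`: from `x` to a neighbour `y` with probability
`a(y) / (4 a(x))`. These numbers form a probability distribution for every `x ≠ 0`. They do not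
for `x = 0`, which is not in the state space of `Ŝ`: there the value is a placeholder. -/
noncomputable def hatStep (x : Z2) : PMF Z2 :=
  if h : ∑ y ∈ nbrs x, ENNReal.ofReal (potentialKernel y / (4 * potentialKernel x)) = 1 then
    PMF.ofFinset
      (fun y => if y ∈ nbrs x then
        ENNReal.ofReal (potentialKernel y / (4 * potentialKernel x)) else 0)
      (nbrs x)
      (by rw [Finset.sum_congr rfl fun y hy => if_pos hy]; exact h)
      (fun _ hy => if_neg hy)
  else PMF.pure x

/-- The law `P̂_x` of the conditioned walk `Ŝ` started from `x ≠ 0`. -/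
noncomputable def hatWalk (x : Z2) : Measure (ℕ → Z2) := chainLaw hatStep x

open Classical in
/-- The equilibrium measure `ê_A(x) = 1{x ∈ A} P̂_x[τ̂₁(A) = ∞] μ_x`, with `μ_x = a(x)²`. -/
noncomputable def hatEquilibrium (A : Finset Z2) (x : Z2) : ℝ :=
  if x ∈ A then (hatWalk x).real {ω | hitTime A ω = ⊤} * potentialKernel x ^ 2 else 0

/-- The capacity with respect to the conditioned walk `Ŝ`. -/
noncomputable def hatCapacity (A : Finset Z2) : ℝ := ∑ x ∈ A, hatEquilibrium A x

/-- Doubly infinite nearest-neighbour transient trajectories, as a set of functions `ℤ → ℤ²`. -/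
def trajSet : Set (ℤ → Z2) :=
  {ϱ | (∀ k, ϱ (k + 1) ∈ nbrs (ϱ k)) ∧ ∀ y, {m | ϱ m = y}.Finite}

/-- The space `W` of trajectories, with its cylinder sigma-field. -/
abbrev W : Type := trajSet

/-- Two trajectories are equivalent if they coincide after a time shift. -/
instance shiftSetoid : Setoid W where
  r ϱ ϱ' := ∃ k : ℤ, ∀ m, ϱ'.1 m = ϱ.1 (m + k)
  iseqv :=
    { refl := fun _ => ⟨0, fun m => by simp⟩
      symm := fun {_ _} ⟨k, hk⟩ => ⟨-k, fun m => by rw [hk]; simp⟩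
      trans := fun {_ _ _} ⟨k, hk⟩ ⟨l, hl⟩ =>
        ⟨l + k, fun m => by rw [hl, hk, add_assoc]⟩ }

/-- The space `W*` of trajectories modulo time shift. Its sigma-field (Mathlib's one on quotients)
consists of the sets whose preimage in `W` is measurable. -/
abbrev WStar : Type := Quotient shiftSetoid

/-- The canonical projection `χ* : W → W*`. -/
def proj (ϱ : W) : WStar := Quotient.mk shiftSetoid ϱ

/-- `W*_A`, the image under the projection of the set of trajectories that intersect `A`. -/
def starThrough (A : Set Z2) : Set WStar := proj '' {ϱ : W | ∃ k, ϱ.1 k ∈ A}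

/-- Glue a forward path (times `≥ 0`) and a backward path (times `≤ -1`). -/
def glue (q : (ℕ → Z2) × (ℕ → Z2)) (k : ℤ) : Z2 :=
  if 0 ≤ k then q.1 k.toNat else q.2 (-k).toNat

lemma measurable_glue : Measurable glue := by
  refine measurable_pi_lambda _ fun k => ?_
  by_cases hk : 0 ≤ k
  · simp only [glue, hk, if_true]; fun_prop
  · simp only [glue, hk, if_false]; fun_prop

/-- The law on `ℤ → ℤ²` under which `ϱ_0 = x` has weight `ê_A(x)` and, given that, `(ϱ_k)_{k ≥ 1}`
is distributed as `Ŝ` under `P̂_x` and, independently, `(ϱ_{-k})_{k ≥ 1}` is distributed as `Ŝ`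
under `P̂_x[ · | τ̂₁(A) = ∞]`. -/
noncomputable def pathQ (A : Finset Z2) : Measure (ℤ → Z2) :=
  ∑ x ∈ A, ENNReal.ofReal (hatEquilibrium A x) •
    ((hatWalk x).prod (ProbabilityTheory.cond (hatWalk x) {ω | hitTime A ω = ⊤})).map glue

lemma measurableSet_trajSet : MeasurableSet trajSet := by
  have h1 : MeasurableSet {ϱ : ℤ → Z2 | ∀ k, ϱ (k + 1) ∈ nbrs (ϱ k)} := by
    rw [Set.ofPred_forall]
    refine MeasurableSet.iInter fun k => ?_
    have : Measurable fun ϱ : ℤ → Z2 => (ϱ (k + 1), ϱ k) := by fun_prop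
    exact this (MeasurableSet.of_discrete (s := {q : Z2 × Z2 | q.1 ∈ nbrs q.2}))
  have h2 : MeasurableSet {ϱ : ℤ → Z2 | ∀ y, {m | ϱ m = y}.Finite} := by
    rw [Set.ofPred_forall]
    refine MeasurableSet.iInter fun y => ?_
    have : {ϱ : ℤ → Z2 | {m | ϱ m = y}.Finite} =
        ⋃ s : Finset ℤ, ⋂ m : ℤ, {ϱ : ℤ → Z2 | ϱ m = y → m ∈ s} := by
      ext ϱ
      simp only [Set.mem_ofPred_eq, Set.mem_iUnion, Set.mem_iInter]
      constructor
      · intro h; exact ⟨h.toFinset, fun m hm => by simpa using hm⟩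
      · rintro ⟨s, hs⟩; exact s.finite_toSet.subset fun m hm => hs m hm
    rw [this]
    refine MeasurableSet.iUnion fun s => MeasurableSet.iInter fun m => ?_
    have hm : Measurable fun ϱ : ℤ → Z2 => ϱ m := by fun_prop
    exact hm (MeasurableSet.of_discrete (s := {z : Z2 | z = y → m ∈ s}))
  exact h1.inter h2

/-- The measure `Q_A`, seen on the (measurable) space `W`. -/
noncomputable def measureQ (A : Finset Z2) : Measure W := (pathQ A).comap Subtype.val

/-- `ν` is the trajectory intensity of two-dimensional random interlacements: it is sigma-finite
and its restriction to `W*_A` is the image of `Q_A` under `χ*`, for every finite `A`. -/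
structure IsIntensity (ν : Measure WStar) : Prop where
  sigmaFinite : SigmaFinite ν
  restrict_eq : ∀ A : Finset Z2, ν.restrict (starThrough A) = (measureQ A).map proj

/-- `η` is a Poisson point process on `E` with intensity measure `Λ`: a random countable sum of
point masses, whose numbers of points in disjoint measurable sets are independent, and have a
Poisson distribution with parameter `Λ B` in each measurable set `B` with `Λ B < ∞`. -/
structure IsPoissonPointProcess {Ω E : Type*} [MeasurableSpace Ω] [MeasurableSpace E]
    (Λ : Measure E) (P : Measure Ω) (η : Ω → Measure E) : Prop where
  measurable : Measurable η
  sum_dirac : ∀ ω, ∃ (I : Set ℕ) (p : I → E), η ω = Measure.sum fun i => Measure.dirac (p i)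
  poisson : ∀ B, MeasurableSet B → Λ B ≠ ∞ →
    P.map (fun ω => η ω B) = (poissonMeasure (Λ B).toNNReal).map (fun n : ℕ => (n : ℝ≥0∞))
  indep : ∀ (n : ℕ) (B : Fin n → Set E), (∀ i, MeasurableSet (B i)) →
    Pairwise (fun i j => Disjoint (B i) (B j)) → iIndepFun (fun i ω => η ω (B i)) P

/-- Random interlacements at level `α`: from a configuration `∑ δ_(w*, u)` of trajectories with
labels keep the trajectories whose label is at most `π α`. -/
noncomputable def interlacement (α : ℝ) (c : Measure (WStar × ℝ)) : Measure WStar :=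
  (c.restrict {q | q.2 ≤ Real.pi * α}).map Prod.fst

/-- The vacant set at level `α`: the sites through which no trajectory of the interlacement at
level `α` passes (the number of such trajectories is zero). -/
def vacantSet (α : ℝ) (c : Measure (WStar × ℝ)) : Set Z2 :=
  {x | interlacement α c (starThrough {x}) = 0}

end RI2D

namespace RI2D

/-! Both capacities come from one quantity, `escapeRate A x`, the limit of E_x[a(S_n); τ₁(A) > n].
The limit exists by optional stopping (`killIter_decomp`), because a is harmonic except for a unit
defect at 0 (`avg_potentialKernel`).

For x ≠ 0 the weights of the h-transform telescope along a path, so a(x) P̂_x[τ̂₁(A) > n] is this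
same expectation and a(x) P̂_x[τ̂₁(A) = ∞] = `escapeRate A x`
(`potentialKernel_mul_hatWalk_hitTime`).

For the harmonic measure, replace a by a(· - y) with y ∉ A. The two functions differ by a bounded
amount and the walk is recurrent, so the limit does not change. The defect now sits at y, and
optional stopping counts the visits to y before the walk from x returns to A. By reversibility the
expected count is P_y[S_{τ₁(A)} = x]. This is `hitLaw_eq`: the hitting probability is `escapeRate A
x` plus a combination of increments of a near -y, which vanish as y → ∞. Hence hm_A(x) = `escapeRate
A x`, and multiplication by a(x) matches the two capacities term by term; at the origin both terms
are 0.

The analytic input is explicit. In rotated coordinates the planar walk is a product of two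
one-dimensional walks. Pairing even and odd times makes the series for a nonnegative; increments of
the paired terms are O(k^{-5/4}) uniformly in space, so dominated convergence applies; return
probabilities at even times are at least of order 1/k, which gives recurrence.

For the interlacement, reversibility of Ŝ with respect to a² makes its doubly infinite law `biLaw`
shift invariant, and Q_A is the restriction of `biLaw` to the paths that first visit A at time 0.
Hence the Q_A are consistent modulo time shift and patch together to ν. Transience of Ŝ keeps all
mass in W, so ν(W*_A) is the hat capacity, and the void probability of a Poisson process finishes
the proof. -/

/-! ### Path laws of Markov chains. -/

/-- Prepend a site to a path. -/
def consPath (x : Z2) (ω : ℕ → Z2) : ℕ → Z2 := fun n => Nat.casesOn n x ω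

@[simp] lemma consPath_zero (x : Z2) (ω : ℕ → Z2) : consPath x ω 0 = x := rfl

@[simp] lemma consPath_succ (x : Z2) (ω : ℕ → Z2) (n : ℕ) : consPath x ω (n + 1) = ω n := rfl

lemma measurable_consPath (x : Z2) : Measurable (consPath x) := by
  refine measurable_pi_lambda _ fun n => ?_
  cases n with
  | zero => exact measurable_const
  | succ n => exact measurable_pi_apply n

/-- The cylinder of the paths that agree with `s` up to time `n`. -/
def cyl (n : ℕ) (s : ℕ → Z2) : Set (ℕ → Z2) := {ω | ∀ i ≤ n, ω i = s i}

lemma cyl_eq_preimage (n : ℕ) (s : ℕ → Z2) :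
    cyl n s = Preorder.frestrictLe (π := fun _ : ℕ => Z2) n ⁻¹'
      {Preorder.frestrictLe (π := fun _ : ℕ => Z2) n s} := by
  ext ω
  simp only [cyl, Set.mem_ofPred_eq, Set.mem_preimage, Set.mem_singleton_iff]
  constructor
  · intro h
    ext1 i
    exact h i (Finset.mem_Iic.1 i.2)
  · intro h i hi
    exact congrFun h ⟨i, Finset.mem_Iic.2 hi⟩

lemma measurableSet_cyl (n : ℕ) (s : ℕ → Z2) : MeasurableSet (cyl n s) := by
  rw [cyl_eq_preimage]
  exact (Preorder.measurable_frestrictLe n) (measurableSet_singleton _)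

/-- The state space is countable, so cylinders are the atoms of the finite-dimensional marginals and
determine them; a finite measure is the unique projective limit of its marginals. -/
lemma measure_eq_of_cyl {μ ν : Measure (ℕ → Z2)} [IsFiniteMeasure μ] [IsFiniteMeasure ν]
    (h : ∀ n s, μ (cyl n s) = ν (cyl n s)) : μ = ν := by
  have hmap : ∀ n, μ.map (Preorder.frestrictLe n) = ν.map (Preorder.frestrictLe n) := by
    intro n
    refine Measure.ext_of_singleton fun t => ?_
    rw [Measure.map_apply (Preorder.measurable_frestrictLe n) (measurableSet_singleton _),
      Measure.map_apply (Preorder.measurable_frestrictLe n) (measurableSet_singleton _)]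
    -- Every finite history extends to an infinite path; the value 0 after time n is arbitrary.
    have : t = Preorder.frestrictLe (π := fun _ : ℕ => Z2) n
        (fun i => if hi : i ≤ n then t ⟨i, Finset.mem_Iic.2 hi⟩ else 0) := by
      ext1 i
      have := Finset.mem_Iic.1 i.2
      simp [this]
    rw [this, ← cyl_eq_preimage, h]
  have hP : IsProjectiveMeasureFamily (fun I : Finset ℕ => μ.map I.restrict) :=
    fun I J hJI => by
      rw [Measure.map_map (by fun_prop) (by fun_prop)]; rfl
  have h1 : IsProjectiveLimit μ (fun I : Finset ℕ => μ.map I.restrict) := fun I => rfl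
  have h2 : IsProjectiveLimit ν (fun I : Finset ℕ => μ.map I.restrict) :=
    (isProjectiveLimit_nat_iff hP ν).2 fun n => (hmap n).symm
  exact h1.unique h2

section chain

variable (p : Z2 → PMF Z2)

instance (x : Z2) : IsProbabilityMeasure (chainLaw p x) := by
  unfold chainLaw; infer_instance

lemma chainLaw_cyl_zero (x : Z2) (s : ℕ → Z2) :
    chainLaw p x (cyl 0 s) = if s 0 = x then 1 else 0 := by
  have h1 : cyl 0 s = Preorder.frestrictLe (π := fun _ : ℕ => Z2) 0 ⁻¹'
      {Preorder.frestrictLe (π := fun _ : ℕ => Z2) 0 s} := cyl_eq_preimage 0 s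
  rw [h1, ← Measure.map_apply (Preorder.measurable_frestrictLe 0) (measurableSet_singleton _),
    chainLaw, Kernel.trajMeasure, Measure.map_comp _ _ (Preorder.measurable_frestrictLe 0),
    Kernel.traj_map_frestrictLe, Kernel.partialTraj_self, Measure.id_comp,
    Measure.map_apply (by fun_prop) (measurableSet_singleton _),
    Measure.dirac_apply' _ (MeasurableSet.of_discrete)]
  have h2 : x ∈ (MeasurableEquiv.piUnique fun i : Finset.Iic 0 => Z2).symm ⁻¹'
      {Preorder.frestrictLe (π := fun _ : ℕ => Z2) 0 s} ↔ s 0 = x := by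
    rw [Set.mem_preimage, Set.mem_singleton_iff]
    constructor
    · intro h
      exact (congrFun h ⟨0, by simp⟩).symm
    · intro h
      ext1 i
      obtain ⟨i, hi⟩ := i
      have : i = 0 := by simpa using hi
      subst this
      exact h.symm
  split_ifs with h
  · exact Set.indicator_of_mem (h2.2 h) _
  · exact Set.indicator_of_notMem (fun h' => h (h2.1 h')) _

lemma chainLaw_cyl_succ (x : Z2) (n : ℕ) (s : ℕ → Z2) :
    chainLaw p x (cyl (n + 1) s) = chainLaw p x (cyl n s) * p (s n) (s (n + 1)) := by
  have key := Kernel.map_frestrictLe_trajMeasure_compProd_eq_map_trajMeasure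
    (X := fun _ : ℕ => Z2) (μ₀ := Measure.dirac x) (κ := fun n =>
    (stepKernel p).comap (fun h : ((i : Finset.Iic n) → Z2) => h ⟨n, Finset.mem_Iic.2 le_rfl⟩)
      (measurable_pi_apply _)) (a := n)
  change (chainLaw p x).map _ ⊗ₘ _ = (chainLaw p x).map _ at key
  have key2 := congrArg (fun m => m ({Preorder.frestrictLe (π := fun _ : ℕ => Z2) n s} ×ˢ
    {s (n + 1)})) key
  rw [Measure.compProd_apply_prod (measurableSet_singleton _) (measurableSet_singleton _),
    Measure.map_apply (by fun_prop) ((measurableSet_singleton _).prod (measurableSet_singleton _)),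
    lintegral_singleton, Measure.map_apply (by fun_prop) (measurableSet_singleton _),
    ← cyl_eq_preimage] at key2
  have h1 : cyl (n + 1) s = (fun x : ℕ → Z2 => (Preorder.frestrictLe n x, x (n + 1))) ⁻¹'
      {Preorder.frestrictLe (π := fun _ : ℕ => Z2) n s} ×ˢ {s (n + 1)} := by
    ext ω
    have := Set.ext_iff.1 (cyl_eq_preimage n s) ω
    simp only [Set.mem_preimage, Set.mem_singleton_iff] at this
    simp only [Set.mem_preimage, Set.mem_prod, Set.mem_singleton_iff, ← this]
    simp only [cyl, Set.mem_ofPred_eq, Nat.le_succ_iff]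
    grind
  rw [h1, ← key2, mul_comm]
  congr 1
  change (p (s n)).toMeasure {s (n + 1)} = _
  rw [PMF.toMeasure_apply_singleton _ _ (measurableSet_singleton _)]

lemma chainLaw_cyl (x : Z2) (n : ℕ) (s : ℕ → Z2) :
    chainLaw p x (cyl n s) =
      if s 0 = x then ∏ i ∈ Finset.range n, p (s i) (s (i + 1)) else 0 := by
  induction n with
  | zero => simp [chainLaw_cyl_zero]
  | succ n ih =>
    rw [chainLaw_cyl_succ, ih, Finset.prod_range_succ]
    split_ifs <;> simp

/-- First-step decomposition of the law of a Markov chain. -/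
lemma chainLaw_eq_sum (x : Z2) :
    chainLaw p x = Measure.sum fun y => p x y • (chainLaw p y).map (consPath x) := by
  have hsum : ∀ E : Set (ℕ → Z2), MeasurableSet E →
      (Measure.sum fun y => p x y • (chainLaw p y).map (consPath x)) E =
        ∑' y, p x y * chainLaw p y (consPath x ⁻¹' E) := by
    intro E hE
    rw [Measure.sum_apply _ hE]
    simp_rw [Measure.smul_apply, Measure.map_apply (measurable_consPath x) hE, smul_eq_mul]
  have hone : ∑' y, p x y = 1 := (p x).tsum_coe
  have : IsFiniteMeasure (Measure.sum fun y => p x y • (chainLaw p y).map (consPath x)) := by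
    refine ⟨?_⟩
    rw [hsum _ MeasurableSet.univ]
    simp [hone]
  refine measure_eq_of_cyl fun n s => ?_
  rw [hsum _ (measurableSet_cyl n s)]
  cases n with
  | zero =>
    have : consPath x ⁻¹' cyl 0 s = if s 0 = x then Set.univ else ∅ := by
      ext ω
      by_cases h : s 0 = x <;> simp [cyl, h, eq_comm]
    rw [chainLaw_cyl_zero, this]
    split_ifs <;> simp [hone]
  | succ n =>
    have : consPath x ⁻¹' cyl (n + 1) s =
        if s 0 = x then cyl n (fun i => s (i + 1)) else ∅ := by
      ext ω
      by_cases h : s 0 = x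
      · simp only [cyl, Set.mem_preimage, Set.mem_ofPred_eq, h, if_true]
        constructor
        · intro h i hi; exact h (i + 1) (by omega)
        · intro h' i hi
          cases i with
          | zero => exact h.symm
          | succ i => exact h' i (by omega)
      · simp only [cyl, Set.mem_preimage, Set.mem_ofPred_eq, h, if_false, Set.mem_empty_iff_false,
          iff_false]
        exact fun h' => h (h' 0 (by omega)).symm
    rw [this, chainLaw_cyl]
    split_ifs with h
    -- The cylinder prescribes the site at time 1, so only one first step contributes.
    · rw [tsum_eq_single (s 1), chainLaw_cyl, Finset.prod_range_succ', mul_comm]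
      · simp [h]
      · intro y hy
        rw [chainLaw_cyl, if_neg (fun h => hy h.symm), mul_zero]
    · simp

lemma chainLaw_apply (x : Z2) {E : Set (ℕ → Z2)} (hE : MeasurableSet E) :
    chainLaw p x E = ∑' y, p x y * chainLaw p y (consPath x ⁻¹' E) := by
  conv_lhs => rw [chainLaw_eq_sum, Measure.sum_apply _ hE]
  simp_rw [Measure.smul_apply, Measure.map_apply (measurable_consPath x) hE, smul_eq_mul]

lemma chainLaw_zero_ae (x : Z2) : ∀ᵐ ω ∂chainLaw p x, ω 0 = x := by
  have h : MeasurableSet {ω : ℕ → Z2 | ¬ω 0 = x} :=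
    (measurableSet_singleton x).compl.preimage (measurable_pi_apply 0)
  rw [ae_iff]
  rw [chainLaw_apply p x h]
  simp

lemma chainLaw_real_apply (x : Z2) {E : Set (ℕ → Z2)} (hE : MeasurableSet E) {s : Finset Z2}
    (hs : ∀ y ∉ s, p x y = 0) :
    (chainLaw p x).real E =
      ∑ y ∈ s, (p x y).toReal * (chainLaw p y).real (consPath x ⁻¹' E) := by
  rw [Measure.real, chainLaw_apply p x hE, tsum_eq_sum (s := s) (fun y hy => by simp [hs y hy]),
    ENNReal.toReal_sum (fun y _ => ENNReal.mul_ne_top ((p x).apply_ne_top y) (measure_ne_top _ _))]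
  simp [Measure.real]

/-- Turns the constraint left at time 0 after a first-step decomposition into a condition on the
starting site, which is the indicator in `killOp`. -/
lemma chainLaw_inter_start (y : Z2) (A : Set Z2) [Decidable (y ∈ A)] (E : Set (ℕ → Z2)) :
    (chainLaw p y).real ({ω | ω 0 ∉ A} ∩ E) = if y ∈ A then 0 else (chainLaw p y).real E := by
  split_ifs with h
  · rw [measureReal_def, measure_mono_null (t := {ω : ℕ → Z2 | ω 0 = y}ᶜ)]
    · simp
    · rintro ω ⟨h1, -⟩ h2
      exact h1 (by rw [show ω 0 = y from h2]; exact h)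
    · exact chainLaw_zero_ae p y
  · refine measureReal_congr ?_
    filter_upwards [chainLaw_zero_ae p y] with ω hω
    simp only [eq_iff_iff]
    change (ω 0 ∉ A ∧ ω ∈ E) ↔ ω ∈ E
    rw [hω]
    tauto

end chain

/-! ### Averages over nearest neighbours. -/

/-- The mean of a function over the four neighbours of a site. -/
noncomputable def avg (f : Z2 → ℝ) (x : Z2) : ℝ := (∑ y ∈ nbrs x, f y) / 4

lemma sum_nbrs {M : Type*} [AddCommMonoid M] (f : Z2 → M) (x : Z2) :
    ∑ y ∈ nbrs x, f y =
      f (x + (1, 0)) + (f (x + (-1, 0)) + (f (x + (0, 1)) + f (x + (0, -1)))) := by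
  unfold nbrs
  rw [Finset.sum_insert, Finset.sum_insert, Finset.sum_insert, Finset.sum_singleton]
  all_goals simp [Prod.ext_iff]

lemma card_nbrs (x : Z2) : (nbrs x).card = 4 := by
  have := sum_nbrs (fun _ => (1 : ℕ)) x
  simpa using this

lemma avg_eq (f : Z2 → ℝ) (x : Z2) :
    avg f x = (f (x + (1, 0)) + f (x + (-1, 0)) + f (x + (0, 1)) + f (x + (0, -1))) / 4 := by
  rw [avg, sum_nbrs]; ring

lemma mem_nbrs {x y : Z2} : y ∈ nbrs x ↔
    y = x + (1, 0) ∨ y = x + (-1, 0) ∨ y = x + (0, 1) ∨ y = x + (0, -1) := by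
  simp [nbrs]

lemma mem_nbrs_comm {x y : Z2} : y ∈ nbrs x ↔ x ∈ nbrs y := by
  simp only [mem_nbrs, Prod.ext_iff, Prod.fst_add, Prod.snd_add]
  constructor <;> intro h <;> omega

lemma mem_nbrs_sub {x y z : Z2} : y - z ∈ nbrs (x - z) ↔ y ∈ nbrs x := by
  simp only [mem_nbrs, Prod.ext_iff, Prod.fst_add, Prod.snd_add, Prod.fst_sub, Prod.snd_sub]
  constructor <;> intro h <;> omega

/-- Induction along nearest-neighbour steps from the origin. -/
lemma nbrs_induction {P : Z2 → Prop} (h0 : P 0) (hs : ∀ x, P x → ∀ y ∈ nbrs x, P y) (x : Z2) :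
    P x := by
  have h1 : ∀ m : ℤ, P (m, 0) := by
    intro m
    induction m using Int.induction_on with
    | zero => exact h0
    | succ i ih => exact hs _ ih _ (by simp [mem_nbrs])
    | pred i ih => exact hs _ ih _ (by simp [mem_nbrs, sub_eq_add_neg])
  obtain ⟨m, n⟩ := x
  induction n using Int.induction_on with
  | zero => exact h1 m
  | succ i ih => exact hs _ ih _ (by simp [mem_nbrs])
  | pred i ih => exact hs _ ih _ (by simp [mem_nbrs, sub_eq_add_neg])

lemma avg_mono {f g : Z2 → ℝ} {x : Z2} (h : ∀ y ∈ nbrs x, f y ≤ g y) : avg f x ≤ avg g x := by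
  unfold avg
  gcongr with y hy
  exact h y hy

lemma avg_congr {f g : Z2 → ℝ} {x : Z2} (h : ∀ y ∈ nbrs x, f y = g y) : avg f x = avg g x := by
  unfold avg
  rw [Finset.sum_congr rfl h]

lemma avg_const (c : ℝ) (x : Z2) : avg (fun _ => c) x = c := by
  rw [avg_eq]; ring

lemma avg_add (f g : Z2 → ℝ) (x : Z2) : avg (fun y => f y + g y) x = avg f x + avg g x := by
  simp only [avg_eq]; ring

lemma avg_sub (f g : Z2 → ℝ) (x : Z2) : avg (fun y => f y - g y) x = avg f x - avg g x := by
  simp only [avg_eq]; ring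

lemma avg_mul_left (c : ℝ) (f : Z2 → ℝ) (x : Z2) : avg (fun y => c * f y) x = c * avg f x := by
  simp only [avg_eq]; ring

lemma avg_sum {ι : Type*} (s : Finset ι) (f : ι → Z2 → ℝ) (x : Z2) :
    avg (fun y => ∑ i ∈ s, f i y) x = ∑ i ∈ s, avg (f i) x := by
  unfold avg
  rw [Finset.sum_comm, Finset.sum_div]

/-- A Harnack-type bound: it carries estimates from a site to its neighbours in arguments by
`nbrs_induction`. -/
lemma le_four_mul_avg {f : Z2 → ℝ} {x y : Z2} (h : ∀ z ∈ nbrs x, 0 ≤ f z) (hy : y ∈ nbrs x) :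
    f y ≤ 4 * avg f x := by
  rw [avg, mul_div_cancel₀ _ (by norm_num : (4 : ℝ) ≠ 0)]
  exact Finset.single_le_sum h hy

lemma tendsto_avg {ι : Type*} {l : Filter ι} {f : ι → Z2 → ℝ} {g : Z2 → ℝ} {x : Z2}
    (h : ∀ y ∈ nbrs x, Tendsto (fun i => f i y) l (𝓝 (g y))) :
    Tendsto (fun i => avg (f i) x) l (𝓝 (avg g x)) :=
  (tendsto_finsetSum _ h).div_const 4

/-! ### Local estimates for the one-dimensional walk. -/

/-- The distribution of one-dimensional simple random walk after `n` steps. -/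
noncomputable def walk1 : ℕ → ℤ → ℝ
  | 0, u => if u = 0 then 1 else 0
  | n + 1, u => (walk1 n (u - 1) + walk1 n (u + 1)) / 2

lemma walk1_nonneg (n : ℕ) (u : ℤ) : 0 ≤ walk1 n u := by
  induction n generalizing u with
  | zero => unfold walk1; split_ifs <;> norm_num
  | succ n ih =>
    unfold walk1
    have := ih (u - 1)
    have := ih (u + 1)
    positivity

lemma walk1_neg (n : ℕ) (u : ℤ) : walk1 n (-u) = walk1 n u := by
  induction n generalizing u with
  | zero => simp [walk1]
  | succ n ih =>
    simp only [walk1]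
    rw [show -u - 1 = -(u + 1) by ring, show -u + 1 = -(u - 1) by ring, ih, ih, add_comm]

lemma walk1_eq_zero (n : ℕ) (u : ℤ) (h : (n + u) % 2 = 1) : walk1 n u = 0 := by
  induction n generalizing u with
  | zero =>
    have : u ≠ 0 := by rintro rfl; simp at h
    simp [walk1, this]
  | succ n ih =>
    simp only [walk1]
    rw [ih _ (by push_cast at h; omega), ih _ (by push_cast at h; omega)]
    norm_num

/-- A division-free form of the ratio of consecutive binomial coefficients; it needs no condition on
parity or range. -/
lemma walk1_ratio (n : ℕ) (u : ℤ) :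
    ((n : ℝ) + 1 + u) * walk1 n (u + 1) = ((n : ℝ) + 1 - u) * walk1 n (u - 1) := by
  induction n generalizing u with
  | zero =>
    simp only [walk1]
    by_cases h1 : u + 1 = 0
    · have : u = -1 := by omega
      subst this; norm_num
    · by_cases h2 : u - 1 = 0
      · have : u = 1 := by omega
        subst this; norm_num
      · simp [h1, h2]
  | succ n ih =>
    have h1 := ih (u + 1)
    have h2 := ih (u - 1)
    simp only [walk1]
    rw [show u + 1 - 1 = u by ring] at *
    rw [show u - 1 + 1 = u by ring] at *
    push_cast at *
    linear_combination (h1 + h2) / 2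

lemma walk1_diff (n : ℕ) (u : ℤ) :
    ((n : ℝ) + 1) * (walk1 n (u + 1) - walk1 n (u - 1)) = -(2 * u * walk1 (n + 1) u) := by
  have := walk1_ratio n u
  simp only [walk1]
  linear_combination this

lemma walk1_center_succ (k : ℕ) :
    ((2 * k + 2 : ℕ) : ℝ) * walk1 (2 * k + 2) 0 = ((2 * k + 1 : ℕ) : ℝ) * walk1 (2 * k) 0 := by
  have h := walk1_ratio (2 * k) 1
  have h1 : walk1 (2 * k + 2) 0 = (walk1 (2 * k) 0 + walk1 (2 * k) 2) / 2 := by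
    have e : walk1 (2 * k) (-1 - 1) = walk1 (2 * k) 2 := walk1_neg (2 * k) 2
    simp only [walk1, zero_sub, zero_add, e]
    norm_num
    ring
  norm_num at h
  rw [h1]
  push_cast
  linear_combination h / 2

/-- The induction closes because (2k+1)(2k+3) and (2k+2)² differ by 1. -/
lemma walk1_center_sq_le (k : ℕ) : walk1 (2 * k) 0 ^ 2 * (2 * k + 1) ≤ 1 := by
  induction k with
  | zero => simp [walk1]
  | succ k ih =>
    have h := walk1_center_succ k
    push_cast at h
    rw [show 2 * (k + 1) = 2 * k + 2 by ring]
    have h2 : (2 * k + 2 : ℝ) ^ 2 * (walk1 (2 * k + 2) 0 ^ 2 * (2 * (k + 1) + 1)) ≤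
        (2 * k + 2 : ℝ) ^ 2 * 1 := by
      calc (2 * k + 2 : ℝ) ^ 2 * (walk1 (2 * k + 2) 0 ^ 2 * (2 * (k + 1) + 1))
          = ((2 * k + 2) * walk1 (2 * k + 2) 0) ^ 2 * (2 * k + 3) := by ring
        _ = (2 * k + 1) * (2 * k + 3) * (walk1 (2 * k) 0 ^ 2 * (2 * k + 1)) := by rw [h]; ring
        _ ≤ (2 * k + 1) * (2 * k + 3) * 1 := by gcongr
        _ ≤ _ := by nlinarith
    push_cast
    exact le_of_mul_le_mul_left h2 (by positivity)

/-- The constant 4k+1 is chosen so that (2k+2)²(4k+1) and (2k+1)²(4k+5) differ by 1. The bound makes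
planar return probabilities non-summable. -/
lemma le_walk1_center_sq (k : ℕ) : 1 ≤ walk1 (2 * k) 0 ^ 2 * (4 * k + 1) := by
  induction k with
  | zero => simp [walk1]
  | succ k ih =>
    have h := walk1_center_succ k
    push_cast at h
    rw [show 2 * (k + 1) = 2 * k + 2 by ring]
    have h2 : (2 * k + 2 : ℝ) ^ 2 * (4 * k + 1) * 1 ≤
        (2 * k + 2 : ℝ) ^ 2 * (4 * k + 1) * (walk1 (2 * k + 2) 0 ^ 2 * (4 * (k + 1) + 1)) := by
      calc (2 * k + 2 : ℝ) ^ 2 * (4 * k + 1) * 1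
          ≤ (2 * k + 1) ^ 2 * (4 * k + 5) * 1 := by nlinarith
        _ ≤ (2 * k + 1) ^ 2 * (4 * k + 5) * (walk1 (2 * k) 0 ^ 2 * (4 * k + 1)) := by gcongr
        _ = ((2 * k + 1) * walk1 (2 * k) 0) ^ 2 * (4 * k + 5) * (4 * k + 1) := by ring
        _ = _ := by rw [← h]; ring
    push_cast
    exact le_of_mul_le_mul_left h2 (by positivity)

/-- `walk1_ratio` at the odd points 2j+1 shows decrease along even points away from 0; odd points
have no mass, and symmetry handles negative ones. -/
lemma walk1_le_center (k : ℕ) (u : ℤ) : walk1 (2 * k) u ≤ walk1 (2 * k) 0 := by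
  have h1 : ∀ j : ℕ, walk1 (2 * k) (2 * j) ≤ walk1 (2 * k) 0 := by
    intro j
    induction j with
    | zero => simp
    | succ j ih =>
      refine le_trans ?_ ih
      have h := walk1_ratio (2 * k) (2 * j + 1)
      rw [show (2 * j + 1 + 1 : ℤ) = 2 * ((j + 1 : ℕ) : ℤ) by push_cast; ring,
        show (2 * j + 1 - 1 : ℤ) = 2 * j by ring] at h
      have hn := walk1_nonneg (2 * k) (2 * j)
      push_cast at h ⊢
      have hp : (0 : ℝ) < 2 * k + 1 + (2 * j + 1) := by positivity
      refine le_of_mul_le_mul_left ?_ hp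
      rw [h]
      refine mul_le_mul_of_nonneg_right ?_ hn
      have : (0 : ℝ) ≤ j := by positivity
      linarith
  have h2 : walk1 (2 * k) u = walk1 (2 * k) u.natAbs := by
    rcases Int.natAbs_eq u with h | h
    · rw [← h]
    · conv_lhs => rw [h, walk1_neg]
  rw [h2]
  rcases Nat.even_or_odd' u.natAbs with ⟨j, hj | hj⟩
  · rw [hj]; exact_mod_cast h1 j
  · rw [walk1_eq_zero _ _ (by rw [hj]; push_cast; omega)]
    exact walk1_nonneg _ _

lemma walk1_odd_le_center (k : ℕ) (u : ℤ) : walk1 (2 * k + 1) u ≤ walk1 (2 * k) 0 := by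
  simp only [walk1]
  linarith [walk1_le_center k (u - 1), walk1_le_center k (u + 1)]

lemma hasSum_walk1 (n : ℕ) :
    HasSum (walk1 n) 1 ∧ HasSum (fun u : ℤ => (u : ℝ) ^ 2 * walk1 n u) n := by
  induction n with
  | zero =>
    constructor
    · exact hasSum_ite_eq (0 : ℤ) (1 : ℝ)
    · have : (fun u : ℤ => (u : ℝ) ^ 2 * walk1 0 u) = fun _ => 0 := by
        ext u
        by_cases h : u = 0 <;> simp [walk1, h]
      rw [this]; simp
  | succ n ih =>
    obtain ⟨h0, h2⟩ := ih
    have shift : ∀ (c : ℤ) {g : ℤ → ℝ} {s : ℝ}, HasSum g s → HasSum (fun u => g (u + c)) s :=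
      fun c g s hg => (Equiv.addRight c).hasSum_iff.2 hg
    constructor
    · have := ((shift (-1) h0).add (shift 1 h0)).div_const 2
      norm_num at this
      exact this
    -- The first moment exists since |2u| ≤ u² + 1. Its value is not needed: it cancels between the
    -- two shifts.
    · have key : Summable fun u : ℤ => (2 * u : ℝ) * walk1 n u := by
        refine Summable.of_norm_bounded (h2.summable.add h0.summable) fun u => ?_
        rw [norm_mul, Real.norm_of_nonneg (walk1_nonneg n u), Real.norm_eq_abs, ← add_one_mul]
        refine mul_le_mul_of_nonneg_right ?_ (walk1_nonneg n u)
        rw [abs_le]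
        constructor <;> nlinarith [sq_nonneg ((u : ℝ) - 1), sq_nonneg ((u : ℝ) + 1)]
      have hp := shift (-1) ((h2.add key.hasSum).add h0)
      have hm := shift 1 ((h2.sub key.hasSum).add h0)
      have := (hp.add hm).div_const 2
      rw [show ((n + 1 : ℕ) : ℝ) = (n + (∑' b : ℤ, 2 * (b : ℝ) * walk1 n b) + 1 +
        (n - (∑' b : ℤ, 2 * (b : ℝ) * walk1 n b) + 1)) / 2 by push_cast; ring]
      convert this using 1
      · rfl
      · funext u
        rw [show walk1 (n + 1) u = (walk1 n (u + -1) + walk1 n (u + 1)) / 2 from rfl]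
        push_cast
        ring

lemma sq_mul_walk1_le (n : ℕ) (u : ℤ) : (u : ℝ) ^ 2 * walk1 n u ≤ n :=
  le_hasSum (hasSum_walk1 n).2 u fun v _ => mul_nonneg (sq_nonneg _) (walk1_nonneg n v)

/-- With N = 2k+1, `walk1_diff` gives the difference as -2u p_N(u)/N. In the square, the variance
bound absorbs u² p_N(u) ≤ N; the remaining factor p_N(u) and the two factors at v are at most the
central value, itself at most N^{-1/2}. The result is 4N^{-5/2}. -/
lemma walk1_diff_mul_sq_le (k : ℕ) (u v : ℤ) :
    ((walk1 (2 * k) (u + 1) - walk1 (2 * k) (u - 1)) * walk1 (2 * k) v) ^ 2 ≤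
      (2 * ((2 * k + 1 : ℕ) : ℝ) ^ (-5 / 4 : ℝ)) ^ 2 := by
  set N : ℝ := ((2 * k + 1 : ℕ) : ℝ) with hN
  have hNpos : 0 < N := by rw [hN]; positivity
  have hdiff : N * (walk1 (2 * k) (u + 1) - walk1 (2 * k) (u - 1)) =
      -(2 * u * walk1 (2 * k + 1) u) := by
    rw [← walk1_diff, hN]; push_cast; ring
  set c := walk1 (2 * k) 0
  have hc0 : 0 ≤ c := walk1_nonneg _ _
  have hc : c ^ 2 * N ≤ 1 := by
    have := walk1_center_sq_le k
    rw [hN]; push_cast; exact this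
  have hc' : c ≤ N ^ (-1 / 2 : ℝ) := by
    refine le_of_sq_le_sq ?_ (by positivity)
    rw [← Real.rpow_natCast (N ^ (-1 / 2 : ℝ)), ← Real.rpow_mul hNpos.le]
    norm_num
    rw [Real.rpow_neg_one, inv_eq_one_div, le_div_iff₀ hNpos]
    exact hc
  have hv0 := walk1_nonneg (2 * k) v
  have hv : walk1 (2 * k) v ^ 2 ≤ c ^ 2 := by
    gcongr; exact walk1_le_center k v
  have hw0 := walk1_nonneg (2 * k + 1) u
  have hw := walk1_odd_le_center k u
  have hs := sq_mul_walk1_le (2 * k + 1) u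
  rw [← hN] at hs
  have hR : (2 * N ^ (-5 / 4 : ℝ)) ^ 2 = 4 * (N ^ (-1 / 2 : ℝ) * (N ^ 2)⁻¹) := by
    rw [mul_pow, ← Real.rpow_natCast (N ^ (-5 / 4 : ℝ)), ← Real.rpow_mul hNpos.le,
      ← Real.rpow_natCast N 2, ← Real.rpow_neg hNpos.le, ← Real.rpow_add hNpos]
    norm_num
  rw [hR]
  have hN3 : 0 < N ^ 3 := by positivity
  have step : N ^ 3 * ((walk1 (2 * k) (u + 1) - walk1 (2 * k) (u - 1)) * walk1 (2 * k) v) ^ 2 ≤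
      N * (4 * N ^ (-1 / 2 : ℝ)) := by
    calc N ^ 3 * ((walk1 (2 * k) (u + 1) - walk1 (2 * k) (u - 1)) * walk1 (2 * k) v) ^ 2
        = N * (N * (walk1 (2 * k) (u + 1) - walk1 (2 * k) (u - 1))) ^ 2 *
            walk1 (2 * k) v ^ 2 := by ring
      _ = 4 * ((u : ℝ) ^ 2 * walk1 (2 * k + 1) u) * walk1 (2 * k + 1) u *
            (N * walk1 (2 * k) v ^ 2) := by rw [hdiff]; ring
      _ ≤ 4 * N * c * (N * c ^ 2) := by gcongr
      _ = N * (4 * c) * (c ^ 2 * N) := by ring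
      _ ≤ N * (4 * c) * 1 := by gcongr
      _ ≤ N * (4 * N ^ (-1 / 2 : ℝ)) := by rw [mul_one]; gcongr
  rw [← mul_le_mul_iff_right₀ hN3]
  refine step.trans (le_of_eq ?_)
  field_simp

/-- A summable bound for the increments of the transition probabilities. -/
noncomputable def incrBound (k : ℕ) : ℝ := 2 * ((2 * k + 1 : ℕ) : ℝ) ^ (-5 / 4 : ℝ)

lemma summable_incrBound : Summable incrBound := by
  have h : Summable fun n : ℕ => (n : ℝ) ^ (-5 / 4 : ℝ) :=
    Real.summable_nat_rpow.2 (by norm_num)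
  exact (h.comp_injective (i := fun k : ℕ => 2 * k + 1) fun a b hab => by
    simpa using hab).mul_left 2

lemma incrBound_nonneg (k : ℕ) : 0 ≤ incrBound k := by unfold incrBound; positivity

lemma abs_walk1_sub_mul_le (k : ℕ) (u u' v : ℤ) (h : u' = u ∨ u' = u + 2 ∨ u = u' + 2) :
    |walk1 (2 * k) u - walk1 (2 * k) u'| * walk1 (2 * k) v ≤ incrBound k := by
  have key : ∀ w : ℤ, |walk1 (2 * k) (w + 1) - walk1 (2 * k) (w - 1)| * walk1 (2 * k) v ≤
      incrBound k := by
    intro w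
    rw [← abs_of_nonneg (walk1_nonneg (2 * k) v), ← abs_mul]
    exact abs_le_of_sq_le_sq (walk1_diff_mul_sq_le k w v) (incrBound_nonneg k)
  rcases h with h | h | h
  · simpa [h] using incrBound_nonneg k
  · have := key (u + 1)
    rw [abs_sub_comm, h]
    convert this using 5 <;> ring
  · have := key (u' + 1)
    rw [h]
    convert this using 5 <;> ring

/-! ### Return probabilities in the plane. -/

/-- The probability that simple random walk on `ℤ²` is at the origin after `n` steps, as a
function of the starting point: in rotated coordinates it is a product. -/
noncomputable def walk2 (n : ℕ) (x : Z2) : ℝ := walk1 n (x.1 + x.2) * walk1 n (x.1 - x.2)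

lemma walk2_zero (x : Z2) : walk2 0 x = if x = 0 then 1 else 0 := by
  simp only [walk2, walk1, Prod.ext_iff, Prod.fst_zero, Prod.snd_zero]
  by_cases h1 : x.1 = 0 <;> by_cases h2 : x.2 = 0 <;> simp [h1, h2]
  intros; omega

lemma walk2_succ (n : ℕ) (x : Z2) : walk2 (n + 1) x = avg (walk2 n) x := by
  obtain ⟨a, b⟩ := x
  rw [avg_eq]
  simp only [walk2, walk1, Prod.mk_add_mk]
  rw [show a + 1 + (b + 0) = a + b + 1 by ring, show a + 1 - (b + 0) = a - b + 1 by ring,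
    show a + -1 + (b + 0) = a + b - 1 by ring, show a + -1 - (b + 0) = a - b - 1 by ring,
    show a + 0 + (b + 1) = a + b + 1 by ring, show a + 0 - (b + 1) = a - b - 1 by ring,
    show a + 0 + (b + -1) = a + b - 1 by ring, show a + 0 - (b + -1) = a - b + 1 by ring]
  ring

lemma walk2_nonneg (n : ℕ) (x : Z2) : 0 ≤ walk2 n x :=
  mul_nonneg (walk1_nonneg _ _) (walk1_nonneg _ _)

lemma walk2_even_center (k : ℕ) : walk2 (2 * k) 0 = walk1 (2 * k) 0 ^ 2 := by
  simp [walk2, sq]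

lemma walk2_even_le (k : ℕ) (x : Z2) : walk2 (2 * k) x ≤ walk2 (2 * k) 0 := by
  rw [walk2_even_center, sq]
  exact mul_le_mul (walk1_le_center _ _) (walk1_le_center _ _) (walk1_nonneg _ _)
    (walk1_nonneg _ _)

lemma walk2_odd_le (k : ℕ) (x : Z2) : walk2 (2 * k + 1) x ≤ walk2 (2 * k) 0 := by
  rw [walk2_succ]
  exact (avg_mono fun y _ => walk2_even_le k y).trans (avg_const _ x).le

/-- By parity one of the two summands vanishes. -/
lemma walk2_even_add_odd_le (k : ℕ) (x : Z2) :
    walk2 (2 * k) x + walk2 (2 * k + 1) x ≤ walk2 (2 * k) 0 := by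
  rcases Int.emod_two_eq_zero_or_one (x.1 + x.2) with h | h
  · have : walk2 (2 * k + 1) x = 0 := by
      rw [walk2, walk1_eq_zero _ _ (by push_cast; omega), zero_mul]
    rw [this, add_zero]; exact walk2_even_le k x
  · have : walk2 (2 * k) x = 0 := by
      rw [walk2, walk1_eq_zero _ _ (by push_cast; omega), zero_mul]
    rw [this, zero_add]; exact walk2_odd_le k x

lemma tendsto_walk2_center : Tendsto (fun k => walk2 (2 * k) 0) atTop (𝓝 0) := by
  refine squeeze_zero (fun k => walk2_nonneg _ _) (fun k => ?_)
    tendsto_one_div_add_atTop_nhds_zero_nat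
  rw [walk2_even_center, le_div_iff₀ (by positivity)]
  refine le_trans ?_ (walk1_center_sq_le k)
  gcongr
  linarith [(Nat.cast_nonneg k : (0 : ℝ) ≤ k)]

lemma walk2_le_center_half (n : ℕ) (x : Z2) : walk2 n x ≤ walk2 (2 * (n / 2)) 0 := by
  rcases Nat.even_or_odd' n with ⟨k, h | h⟩
  · subst h; rw [show 2 * k / 2 = k by omega]; exact walk2_even_le k x
  · subst h; rw [show (2 * k + 1) / 2 = k by omega]; exact walk2_odd_le k x

lemma tendsto_walk2 (x : Z2) : Tendsto (fun n => walk2 n x) atTop (𝓝 0) :=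
  squeeze_zero (fun n => walk2_nonneg n x) (fun n => walk2_le_center_half n x)
    (tendsto_walk2_center.comp (Nat.tendsto_div_const_atTop (by norm_num)))

lemma tendsto_walk2_cofinite (n : ℕ) : Tendsto (walk2 n) cofinite (𝓝 0) := by
  induction n with
  | zero =>
    refine tendsto_const_nhds.congr' ?_
    filter_upwards [(Set.finite_singleton (0 : Z2)).compl_mem_cofinite] with x hx
    rw [walk2_zero, if_neg (by simpa using hx)]
  | succ n ih =>
    have h : ∀ c : Z2, Tendsto (fun x => walk2 n (x + c)) cofinite (𝓝 0) := fun c =>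
      ih.comp (add_left_injective c).tendsto_cofinite
    have := ((((h (1, 0)).add (h (-1, 0))).add (h (0, 1))).add (h (0, -1))).div_const 4
    norm_num at this
    refine this.congr fun x => ?_
    rw [walk2_succ, avg_eq]

/-- The even times alone dominate a quarter of the harmonic series. -/
lemma tendsto_sum_walk2_center :
    Tendsto (fun n => ∑ k ∈ Finset.range n, walk2 k 0) atTop atTop := by
  have hmono : Monotone fun n => ∑ k ∈ Finset.range n, walk2 k 0 := fun m n h =>
    Finset.sum_le_sum_of_subset_of_nonneg (Finset.range_mono h) fun _ _ _ => walk2_nonneg _ _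
  have hle : ∀ m : ℕ, (∑ i ∈ Finset.range m, (1 / (i + 1 : ℝ))) / 4 ≤
      ∑ k ∈ Finset.range (2 * m), walk2 k 0 := by
    intro m
    induction m with
    | zero => simp
    | succ m ih =>
      rw [Finset.sum_range_succ, add_div, show 2 * (m + 1) = 2 * m + 1 + 1 by ring,
        Finset.sum_range_succ, Finset.sum_range_succ, add_assoc]
      have h1 := le_walk1_center_sq m
      have h2 := walk2_nonneg (2 * m + 1) 0
      have h3 : 1 / (m + 1 : ℝ) / 4 ≤ walk2 (2 * m) 0 := by
        rw [walk2_even_center, div_div, div_le_iff₀ (by positivity)]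
        refine h1.trans ?_
        gcongr
        linarith
      linarith
  have h1 : Tendsto (fun m : ℕ => ∑ k ∈ Finset.range (2 * m), walk2 k 0) atTop atTop :=
    tendsto_atTop_mono hle (Real.tendsto_sum_range_one_div_nat_succ_atTop.atTop_div_const
      (by norm_num))
  exact tendsto_atTop_atTop.2 fun b => by
    obtain ⟨m, hm⟩ := (tendsto_atTop_atTop.1 h1 b)
    exact ⟨2 * m, fun n hn => (hm m le_rfl).trans (hmono hn)⟩

/-- Two neighbours of a common site differ by 0 or ±2 in each rotated coordinate, so the product can
be changed one factor at a time. -/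
lemma abs_walk2_even_sub_le (k : ℕ) (x : Z2) {y z : Z2} (hy : y ∈ nbrs x) (hz : z ∈ nbrs x) :
    |walk2 (2 * k) y - walk2 (2 * k) z| ≤ 2 * incrBound k := by
  have hu : z.1 + z.2 = y.1 + y.2 ∨ z.1 + z.2 = y.1 + y.2 + 2 ∨ y.1 + y.2 = z.1 + z.2 + 2 := by
    simp only [mem_nbrs, Prod.ext_iff, Prod.fst_add, Prod.snd_add] at hy hz
    omega
  have hv : z.1 - z.2 = y.1 - y.2 ∨ z.1 - z.2 = y.1 - y.2 + 2 ∨ y.1 - y.2 = z.1 - z.2 + 2 := by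
    simp only [mem_nbrs, Prod.ext_iff, Prod.fst_add, Prod.snd_add] at hy hz
    omega
  have h1 := abs_walk1_sub_mul_le k _ _ (y.1 - y.2) hu
  have h2 := abs_walk1_sub_mul_le k _ _ (z.1 + z.2) hv
  rw [← abs_of_nonneg (walk1_nonneg (2 * k) (y.1 - y.2)), ← abs_mul] at h1
  rw [← abs_of_nonneg (walk1_nonneg (2 * k) (z.1 + z.2)), ← abs_mul] at h2
  calc |walk2 (2 * k) y - walk2 (2 * k) z|
      = |(walk1 (2 * k) (y.1 + y.2) - walk1 (2 * k) (z.1 + z.2)) * walk1 (2 * k) (y.1 - y.2) +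
          (walk1 (2 * k) (y.1 - y.2) - walk1 (2 * k) (z.1 - z.2)) *
            walk1 (2 * k) (z.1 + z.2)| := by
        unfold walk2; congr 1; ring
    _ ≤ _ := (abs_add_le _ _).trans (by linarith)

/-! ### The potential kernel: convergence, positivity, harmonicity. -/

lemma srw_real_apply (x : Z2) {E : Set (ℕ → Z2)} (hE : MeasurableSet E) :
    (srw x).real E = avg (fun y => (srw y).real (consPath x ⁻¹' E)) x := by
  unfold srw
  rw [chainLaw_real_apply _ x hE (s := nbrs x), avg, Finset.sum_div]
  · refine Finset.sum_congr rfl fun y hy => ?_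
    rw [PMF.uniformOfFinset_apply_of_mem _ hy, card_nbrs, div_eq_inv_mul]
    norm_num
  · exact fun y hy => PMF.uniformOfFinset_apply_of_notMem _ hy

instance (x : Z2) : IsProbabilityMeasure (srw x) := by unfold srw; infer_instance

lemma measurableSet_eval (n : ℕ) (s : Set Z2) : MeasurableSet {ω : ℕ → Z2 | ω n ∈ s} :=
  MeasurableSet.preimage (MeasurableSet.of_discrete (s := s)) (measurable_pi_apply n)

open Classical in
lemma chainLaw_real_start (p : Z2 → PMF Z2) (x : Z2) (s : Set Z2) :
    (chainLaw p x).real {ω | ω 0 ∈ s} = if x ∈ s then 1 else 0 := by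
  have h := chainLaw_inter_start p x sᶜ Set.univ
  have e : {ω : ℕ → Z2 | ω 0 ∉ sᶜ} ∩ Set.univ = {ω | ω 0 ∈ s} := by ext; simp
  rw [e] at h
  rw [h]
  by_cases hx : x ∈ s <;> simp [hx]

lemma srw_return (n : ℕ) (x : Z2) : (srw x).real {ω | ω n = 0} = walk2 n x := by
  induction n generalizing x with
  | zero =>
    classical
    have := chainLaw_real_start
      (fun y => PMF.uniformOfFinset (nbrs y) (nbrs_nonempty y)) x {0}
    simp only [Set.mem_singleton_iff] at this
    rw [walk2_zero, ← this]; rfl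
  | succ n ih =>
    rw [srw_real_apply x (E := {ω | ω (n + 1) = 0}) (measurableSet_eval (n + 1) {0}), walk2_succ]
    exact avg_congr fun y _ => ih y

lemma potentialPartialSum_eq (x : Z2) (n : ℕ) :
    potentialPartialSum x n = ∑ k ∈ Finset.range n, (walk2 k 0 - walk2 k x) := by
  simp only [potentialPartialSum, srw_return]

/-- Averaging advances the walk by one step, so the sums telescope. The boundary term at time 0 is
the future defect at the origin. -/
lemma avg_potentialPartialSum (x : Z2) (n : ℕ) :
    avg (fun y => potentialPartialSum y n) x =
      potentialPartialSum x n + walk2 0 x - walk2 n x := by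
  simp only [potentialPartialSum_eq]
  rw [avg_sum]
  have : ∀ k, avg (fun y => walk2 k 0 - walk2 k y) x = walk2 k 0 - walk2 (k + 1) x := by
    intro k
    rw [avg_sub, avg_const, walk2_succ]
  simp only [this, Finset.sum_sub_distrib]
  have h := Finset.sum_range_succ' (fun k => walk2 k x) n
  rw [Finset.sum_range_succ] at h
  linarith

lemma potentialPartialSum_zero (n : ℕ) : potentialPartialSum 0 n = 0 := by
  simp [potentialPartialSum_eq]

/-- The terms of the potential kernel, grouped in pairs. -/
noncomputable def pairTerm (x : Z2) (k : ℕ) : ℝ :=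
  (walk2 (2 * k) 0 + walk2 (2 * k + 1) 0) - (walk2 (2 * k) x + walk2 (2 * k + 1) x)

/-- A single odd-time term can be negative, but not its sum with the preceding even-time term.
Convergence is thereby reduced to boundedness. -/
lemma pairTerm_nonneg (x : Z2) (k : ℕ) : 0 ≤ pairTerm x k := by
  unfold pairTerm
  linarith [walk2_even_add_odd_le k x, walk2_nonneg (2 * k + 1) 0]

lemma sum_pairTerm (x : Z2) (m : ℕ) :
    ∑ k ∈ Finset.range m, pairTerm x k = potentialPartialSum x (2 * m) := by
  rw [potentialPartialSum_eq]
  induction m with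
  | zero => simp
  | succ m ih =>
    rw [Finset.sum_range_succ, ih, show 2 * (m + 1) = 2 * m + 1 + 1 by ring,
      Finset.sum_range_succ, Finset.sum_range_succ, pairTerm]
    ring

lemma potentialPartialSum_even_nonneg (x : Z2) (m : ℕ) : 0 ≤ potentialPartialSum x (2 * m) := by
  rw [← sum_pairTerm]
  exact Finset.sum_nonneg fun k _ => pairTerm_nonneg x k

/-- Even partial sums are nonnegative and their average exceeds the value at x by at most 1, so a
bound C at x yields 4(C+1) at its neighbours. -/
lemma exists_potentialPartialSum_le (x : Z2) : ∃ C, ∀ m, potentialPartialSum x (2 * m) ≤ C := by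
  induction x using nbrs_induction with
  | h0 => exact ⟨0, fun m => (potentialPartialSum_zero _).le⟩
  | hs x ih y hy =>
    obtain ⟨C, hC⟩ := ih
    refine ⟨4 * (C + 1), fun m => ?_⟩
    have h := le_four_mul_avg (f := fun y => potentialPartialSum y (2 * m))
      (fun z _ => potentialPartialSum_even_nonneg z m) hy
    simp only [avg_potentialPartialSum] at h
    have h1 := hC m
    have h2 := walk2_nonneg (2 * m) x
    have h3 : walk2 0 x ≤ 1 := by rw [walk2_zero]; split_ifs <;> norm_num
    linarith

lemma summable_pairTerm (x : Z2) : Summable (pairTerm x) := by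
  obtain ⟨C, hC⟩ := exists_potentialPartialSum_le x
  exact summable_of_sum_range_le (pairTerm_nonneg x) fun m => by rw [sum_pairTerm]; exact hC m

lemma tendsto_potentialPartialSum_tsum (x : Z2) :
    Tendsto (potentialPartialSum x) atTop (𝓝 (∑' k, pairTerm x k)) := by
  have h := (summable_pairTerm x).hasSum.tendsto_sum_nat
  simp only [sum_pairTerm] at h
  have hdiff : Tendsto (fun n => walk2 n 0 - walk2 n x) atTop (𝓝 0) := by
    simpa using (tendsto_walk2 0).sub (tendsto_walk2 x)
  -- Odd and even partial sums differ by one term, which tends to 0.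
  have hodd : Tendsto (fun m => potentialPartialSum x (2 * m + 1)) atTop
      (𝓝 (∑' k, pairTerm x k)) := by
    have h2 := h.add (hdiff.comp (tendsto_id.const_mul_atTop' (by norm_num : 0 < 2)))
    rw [add_zero] at h2
    refine h2.congr fun m => ?_
    simp only [potentialPartialSum_eq, Finset.sum_range_succ, Function.comp, id]
  rw [Metric.tendsto_atTop] at h hodd ⊢
  intro ε hε
  obtain ⟨N1, h1⟩ := h ε hε
  obtain ⟨N2, h2⟩ := hodd ε hε
  refine ⟨2 * (N1 + N2) + 1, fun n hn => ?_⟩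
  rcases Nat.even_or_odd' n with ⟨k, hk | hk⟩
  · rw [hk]; exact h1 k (by omega)
  · rw [hk]; exact h2 k (by omega)

lemma potentialKernel_eq_tsum (x : Z2) : potentialKernel x = ∑' k, pairTerm x k :=
  (tendsto_potentialPartialSum_tsum x).limUnder_eq

/-- The series that defines the potential kernel converges. -/
lemma tendsto_potentialPartialSum (x : Z2) :
    Tendsto (potentialPartialSum x) atTop (𝓝 (potentialKernel x)) := by
  rw [potentialKernel_eq_tsum]; exact tendsto_potentialPartialSum_tsum x

@[simp] lemma potentialKernel_zero : potentialKernel 0 = 0 := by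
  refine tendsto_nhds_unique (tendsto_potentialPartialSum 0) ?_
  simp only [funext potentialPartialSum_zero]
  exact tendsto_const_nhds

lemma potentialKernel_pos {x : Z2} (hx : x ≠ 0) : 0 < potentialKernel x := by
  rw [potentialKernel_eq_tsum]
  refine (summable_pairTerm x).tsum_pos (pairTerm_nonneg x) 0 ?_
  -- The pair k = 0 is already strictly positive: starting at 0 contributes 1, which exceeds the
  -- chance of stepping from x to 0.
  have h1 : walk2 1 x < 1 := by
    rw [walk2_succ]
    simp only [avg_eq, walk2_zero, Prod.ext_iff, Prod.fst_add, Prod.snd_add, Prod.fst_zero,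
      Prod.snd_zero]
    split_ifs <;> first | omega | norm_num
  have h2 := walk2_nonneg 1 0
  simp only [pairTerm, mul_zero, zero_add, walk2_zero, hx, if_true, if_false]
  linarith

lemma potentialKernel_nonneg (x : Z2) : 0 ≤ potentialKernel x := by
  rw [potentialKernel_eq_tsum]
  exact tsum_nonneg (pairTerm_nonneg x)

/-- The potential kernel is harmonic except at the origin. -/
lemma avg_potentialKernel (x : Z2) :
    avg potentialKernel x = potentialKernel x + if x = 0 then 1 else 0 := by
  have h1 := tendsto_avg (f := fun n y => potentialPartialSum y n) (x := x)
    fun y _ => tendsto_potentialPartialSum y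
  refine tendsto_nhds_unique h1 ?_
  simp only [avg_potentialPartialSum]
  have := ((tendsto_potentialPartialSum x).add_const (walk2 0 x)).sub (tendsto_walk2 x)
  rw [sub_zero] at this
  rwa [← walk2_zero]

/-! ### Increments of the potential kernel. -/

/-- One step from y leads to sites of the same parity as x that share the neighbour y with it. At
equal times there would be no cancellation, since one of the two values vanishes by parity. -/
lemma abs_walk2_even_sub_odd_le (k : ℕ) {x y : Z2} (hy : y ∈ nbrs x) :
    |walk2 (2 * k) x - walk2 (2 * k + 1) y| ≤ 2 * incrBound k := by
  have h : walk2 (2 * k) x - walk2 (2 * k + 1) y =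
      avg (fun z => walk2 (2 * k) x - walk2 (2 * k) z) y := by
    rw [avg_sub, avg_const, walk2_succ]
  have hz : ∀ z ∈ nbrs y, |walk2 (2 * k) x - walk2 (2 * k) z| ≤ 2 * incrBound k :=
    fun z hz => abs_walk2_even_sub_le k y (mem_nbrs_comm.1 hy) hz
  rw [h, abs_le]
  constructor
  · rw [← avg_const (-(2 * incrBound k)) y]
    exact avg_mono fun z h => (abs_le.1 (hz z h)).1
  · rw [← avg_const (2 * incrBound k) y]
    exact avg_mono fun z h => (abs_le.1 (hz z h)).2

lemma abs_pairTerm_sub_le (k : ℕ) {x y : Z2} (hy : y ∈ nbrs x) :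
    |pairTerm y k - pairTerm x k| ≤ 4 * incrBound k := by
  have h1 := abs_walk2_even_sub_odd_le k hy
  have h2 := abs_walk2_even_sub_odd_le k (mem_nbrs_comm.1 hy)
  rw [abs_le] at h1 h2 ⊢
  unfold pairTerm
  constructor <;> linarith [h1.1, h1.2, h2.1, h2.2]

lemma tendsto_potentialKernel_sub_of_mem_nbrs {d : Z2} (hd : d ∈ nbrs 0) :
    Tendsto (fun x => potentialKernel (x + d) - potentialKernel x) cofinite (𝓝 0) := by
  have hmem : ∀ x, x + d ∈ nbrs x := fun x => by
    have := (mem_nbrs_sub (x := x) (y := x + d) (z := x)).1 (by simpa using hd)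
    exact this
  have hlim : Tendsto (fun x => ∑' k, (pairTerm (x + d) k - pairTerm x k)) cofinite
      (𝓝 (∑' _ : ℕ, (0 : ℝ))) := by
    -- The bound is uniform in x and summable in k, so the limit at infinity is taken term by term.
    refine tendsto_tsum_of_dominated_convergence (summable_incrBound.mul_left 4)
      (fun k => ?_) (Eventually.of_forall fun x k => abs_pairTerm_sub_le k (hmem x))
    have hw : ∀ n, Tendsto (fun x => walk2 n (x + d)) cofinite (𝓝 0) := fun n =>
      (tendsto_walk2_cofinite n).comp (add_left_injective d).tendsto_cofinite
    have := ((tendsto_walk2_cofinite (2 * k)).add (tendsto_walk2_cofinite (2 * k + 1))).sub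
      ((hw (2 * k)).add (hw (2 * k + 1)))
    norm_num at this
    refine this.congr fun x => ?_
    simp only [pairTerm]
    ring
  rw [tsum_zero] at hlim
  refine hlim.congr fun x => ?_
  rw [(summable_pairTerm _).tsum_sub (summable_pairTerm _), potentialKernel_eq_tsum,
    potentialKernel_eq_tsum]

/-- The increments of the potential kernel vanish at infinity. -/
lemma tendsto_potentialKernel_sub (d : Z2) :
    Tendsto (fun x => potentialKernel (x + d) - potentialKernel x) cofinite (𝓝 0) := by
  induction d using nbrs_induction with
  | h0 => simp
  | hs d ih e he =>
    have h1 : e - d ∈ nbrs 0 := by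
      have := (mem_nbrs_sub (z := d)).2 he
      rwa [sub_self] at this
    have h2 := ((tendsto_potentialKernel_sub_of_mem_nbrs h1).comp
      (add_left_injective d).tendsto_cofinite).add ih
    rw [add_zero] at h2
    refine h2.congr fun x => ?_
    simp only [Function.comp]
    rw [show x + d + (e - d) = x + e by abel]
    ring

lemma exists_abs_potentialKernel_sub_le (d : Z2) :
    ∃ C, 0 ≤ C ∧ ∀ x, |potentialKernel (x + d) - potentialKernel x| ≤ C := by
  have h := (tendsto_potentialKernel_sub d).abs
  rw [abs_zero] at h
  have hfin : {x | ¬|potentialKernel (x + d) - potentialKernel x| < 1}.Finite :=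
    h.eventually (gt_mem_nhds one_pos)
  obtain ⟨C, hC⟩ := (hfin.image fun x => |potentialKernel (x + d) - potentialKernel x|).bddAbove
  refine ⟨max C 1, le_max_of_le_right zero_le_one, fun x => ?_⟩
  by_cases hx : |potentialKernel (x + d) - potentialKernel x| < 1
  · exact le_max_of_le_right hx.le
  · exact le_max_of_le_left (hC ⟨x, hx, rfl⟩)

/-! ### Simple random walk killed on a finite set. -/

/-- The one-step operator of simple random walk killed on `A`. -/
noncomputable def killOp (A : Finset Z2) (f : Z2 → ℝ) (x : Z2) : ℝ :=
  avg (fun y => if y ∈ A then 0 else f y) x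

/-- `killIter A n f x = E_x[f(S_n); τ₁(A) > n]`. -/
noncomputable def killIter (A : Finset Z2) (n : ℕ) (f : Z2 → ℝ) : Z2 → ℝ := (killOp A)^[n] f

/-- The one-step transition probabilities of simple random walk. -/
noncomputable def stepProb (x y : Z2) : ℝ := if y ∈ nbrs x then 1 / 4 else 0

/-- `firstHit A k x y = P_x[τ₁(A) > k, S_{k+1} = y]`. -/
noncomputable def firstHit (A : Finset Z2) (k : ℕ) (x y : Z2) : ℝ :=
  killIter A k (fun x' => stepProb x' y) x

section killed

variable (A : Finset Z2)

@[simp] lemma killIter_zero (f : Z2 → ℝ) : killIter A 0 f = f := rfl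

lemma killIter_succ (n : ℕ) (f : Z2 → ℝ) :
    killIter A (n + 1) f = killOp A (killIter A n f) :=
  Function.iterate_succ_apply' _ _ _

lemma killIter_succ' (n : ℕ) (f : Z2 → ℝ) :
    killIter A (n + 1) f = killIter A n (killOp A f) :=
  Function.iterate_succ_apply _ _ _

lemma killOp_add (f g : Z2 → ℝ) :
    killOp A (fun x => f x + g x) = fun x => killOp A f x + killOp A g x := by
  funext x
  unfold killOp
  rw [← avg_add]
  exact avg_congr fun y _ => by split_ifs <;> simp

lemma killOp_sub (f g : Z2 → ℝ) :
    killOp A (fun x => f x - g x) = fun x => killOp A f x - killOp A g x := by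
  funext x
  unfold killOp
  rw [← avg_sub]
  exact avg_congr fun y _ => by split_ifs <;> simp

lemma killOp_mul_left (c : ℝ) (f : Z2 → ℝ) :
    killOp A (fun x => c * f x) = fun x => c * killOp A f x := by
  funext x
  unfold killOp
  rw [← avg_mul_left]
  exact avg_congr fun y _ => by split_ifs <;> simp

lemma killOp_const_zero : killOp A (fun _ => 0) = fun _ => 0 := by
  funext x; simp [killOp, avg_const]

lemma killIter_const_zero (n : ℕ) : killIter A n (fun _ => 0) = fun _ => 0 := by
  induction n with
  | zero => rfl
  | succ n ih => rw [killIter_succ, ih, killOp_const_zero]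

lemma killIter_add (n : ℕ) (f g : Z2 → ℝ) :
    killIter A n (fun x => f x + g x) = fun x => killIter A n f x + killIter A n g x := by
  induction n with
  | zero => rfl
  | succ n ih => rw [killIter_succ, ih, killOp_add, killIter_succ, killIter_succ]

lemma killIter_sub (n : ℕ) (f g : Z2 → ℝ) :
    killIter A n (fun x => f x - g x) = fun x => killIter A n f x - killIter A n g x := by
  induction n with
  | zero => rfl
  | succ n ih => rw [killIter_succ, ih, killOp_sub, killIter_succ, killIter_succ]

lemma killIter_mul_left (n : ℕ) (c : ℝ) (f : Z2 → ℝ) :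
    killIter A n (fun x => c * f x) = fun x => c * killIter A n f x := by
  induction n with
  | zero => rfl
  | succ n ih => rw [killIter_succ, ih, killOp_mul_left, killIter_succ]

lemma killIter_sum {ι : Type*} (n : ℕ) (s : Finset ι) (f : ι → Z2 → ℝ) :
    killIter A n (fun x => ∑ i ∈ s, f i x) = fun x => ∑ i ∈ s, killIter A n (f i) x := by
  classical
  induction s using Finset.induction_on with
  | empty => simp [killIter_const_zero]
  | insert i s hi ih =>
    simp only [Finset.sum_insert hi]
    rw [killIter_add, ih]

variable {A}

lemma killOp_mono {f g : Z2 → ℝ} (h : ∀ x, f x ≤ g x) (x : Z2) :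
    killOp A f x ≤ killOp A g x := by
  refine avg_mono fun y _ => ?_
  split_ifs
  · exact le_rfl
  · exact h y

lemma killIter_mono {f g : Z2 → ℝ} (h : ∀ x, f x ≤ g x) (n : ℕ) (x : Z2) :
    killIter A n f x ≤ killIter A n g x := by
  induction n generalizing x with
  | zero => exact h x
  | succ n ih => rw [killIter_succ, killIter_succ]; exact killOp_mono ih x

lemma killIter_nonneg {f : Z2 → ℝ} (h : ∀ x, 0 ≤ f x) (n : ℕ) (x : Z2) :
    0 ≤ killIter A n f x := by
  have := killIter_mono (A := A) (f := fun _ => 0) (g := f) h n x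
  rwa [killIter_const_zero] at this

lemma killOp_anti {B : Finset Z2} (hAB : A ⊆ B) {f : Z2 → ℝ} (hf : ∀ x, 0 ≤ f x) (x : Z2) :
    killOp B f x ≤ killOp A f x := by
  refine avg_mono fun y _ => ?_
  by_cases h : y ∈ A
  · simp [h, hAB h]
  · simp only [h, if_false]
    split_ifs
    · exact hf y
    · exact le_rfl

lemma killIter_anti {B : Finset Z2} (hAB : A ⊆ B) {f : Z2 → ℝ} (hf : ∀ x, 0 ≤ f x) (n : ℕ)
    (x : Z2) : killIter B n f x ≤ killIter A n f x := by
  induction n generalizing x with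
  | zero => exact le_rfl
  | succ n ih =>
    rw [killIter_succ, killIter_succ]
    exact (killOp_mono ih x).trans (killOp_anti hAB (killIter_nonneg hf n) x)

lemma stepProb_nonneg (x y : Z2) : 0 ≤ stepProb x y := by
  unfold stepProb; split_ifs <;> norm_num

lemma stepProb_comm (x y : Z2) : stepProb x y = stepProb y x := by
  unfold stepProb
  simp only [mem_nbrs_comm (x := x) (y := y)]

lemma firstHit_nonneg (k : ℕ) (x y : Z2) : 0 ≤ firstHit A k x y :=
  killIter_nonneg (fun _ => stepProb_nonneg _ _) k x

lemma avg_ite_eq (x y : Z2) : avg (fun z => if z = y then 1 else 0) x = stepProb x y := by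
  unfold avg stepProb
  rw [Finset.sum_ite_eq']
  split_ifs <;> norm_num

lemma avg_eq_sum_stepProb {s : Finset Z2} (f : Z2 → ℝ) (x : Z2) (hs : nbrs x ⊆ s) :
    avg f x = ∑ y ∈ s, stepProb x y * f y := by
  rw [avg, Finset.sum_div, ← Finset.sum_subset hs]
  · refine Finset.sum_congr rfl fun y hy => ?_
    rw [stepProb, if_pos hy]; ring
  · intro y _ hy
    rw [stepProb, if_neg hy, zero_mul]

lemma avg_indicator (A : Finset Z2) (f : Z2 → ℝ) (x : Z2) :
    avg (fun y => if y ∈ A then f y else 0) x = ∑ z ∈ A, f z * stepProb x z := by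
  rw [avg_eq_sum_stepProb _ x (Finset.subset_union_left (s₂ := A))]
  rw [← Finset.sum_subset (Finset.subset_union_right (s₁ := nbrs x))]
  · refine Finset.sum_congr rfl fun y hy => ?_
    rw [if_pos hy, mul_comm]
  · intro y _ hy
    rw [if_neg hy, mul_zero]

lemma avg_split (A : Finset Z2) (f : Z2 → ℝ) (x : Z2) :
    avg f x = killOp A f x + ∑ z ∈ A, f z * stepProb x z := by
  rw [← avg_indicator, killOp, ← avg_add]
  exact avg_congr fun y _ => by split_ifs <;> simp

/-- Optional stopping for the walk killed on `A`. -/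
lemma killIter_decomp (A : Finset Z2) {f c : Z2 → ℝ} (h : ∀ x, avg f x = f x + c x) (n : ℕ)
    (x : Z2) :
    killIter A n f x = f x + ∑ k ∈ Finset.range n, killIter A k c x -
      ∑ z ∈ A, f z * ∑ k ∈ Finset.range n, firstHit A k x z := by
  induction n with
  | zero => simp
  | succ n ih =>
    have e : killOp A f = fun x => f x + c x - ∑ z ∈ A, f z * stepProb x z := by
      funext x
      have := avg_split A f x
      rw [h] at this
      linarith
    have h1 : killIter A (n + 1) f x =
        killIter A n f x + killIter A n c x - ∑ z ∈ A, f z * firstHit A n x z := by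
      rw [killIter_succ', e, killIter_sub, killIter_add, killIter_sum]
      simp only [killIter_mul_left]
      rfl
    rw [h1, ih]
    simp only [Finset.sum_range_succ, mul_add, Finset.sum_add_distrib]
    ring

lemma firstHit_succ (k : ℕ) (x y : Z2) :
    firstHit A (k + 1) x y = avg (fun x' => if x' ∈ A then 0 else firstHit A k x' y) x := by
  unfold firstHit
  rw [killIter_succ]
  rfl

lemma killOp_stepProb (x y : Z2) :
    killOp A (fun x' => stepProb x' y) x =
      avg (fun z => if z ∈ A then 0 else stepProb x z) y := by
  rw [killOp, avg_eq_sum_stepProb _ x (Finset.subset_union_left (s₂ := nbrs y)),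
    avg_eq_sum_stepProb _ y (Finset.subset_union_right (s₁ := nbrs x))]
  refine Finset.sum_congr rfl fun z _ => ?_
  rw [stepProb_comm y z]
  split_ifs
  · simp
  · ring

/-- Splits off the last step where `firstHit_succ` splits off the first; comparing the two
recursions gives reversibility. -/
lemma firstHit_succ' (k : ℕ) (x y : Z2) :
    firstHit A (k + 1) x y = avg (fun y' => if y' ∈ A then 0 else firstHit A k x y') y := by
  have e : killOp A (fun x' => stepProb x' y) =
      fun x => 1 / 4 * ∑ z ∈ nbrs y, if z ∈ A then 0 else stepProb x z := by
    funext x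
    rw [killOp_stepProb, avg]
    ring
  rw [firstHit, killIter_succ', e, killIter_mul_left, killIter_sum, avg]
  simp only [one_div_mul_eq_div]
  congr 1
  refine Finset.sum_congr rfl fun z _ => ?_
  split_ifs
  · rw [killIter_const_zero]
  · rfl

/-- Reversibility of the killed walk. -/
lemma firstHit_comm (k : ℕ) (x y : Z2) : firstHit A k x y = firstHit A k y x := by
  induction k generalizing x y with
  | zero => exact stepProb_comm x y
  | succ k ih =>
    rw [firstHit_succ, firstHit_succ']
    exact avg_congr fun z _ => by rw [ih]

lemma killIter_ite_eq_of_mem {w : Z2} (hw : w ∈ A) (k : ℕ) (x : Z2) :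
    killIter A (k + 1) (fun z => if z = w then 1 else 0) x = 0 := by
  have : killOp A (fun z => if z = w then 1 else 0) = fun _ => 0 := by
    funext x
    rw [killOp]
    refine (avg_congr fun y _ => ?_).trans (avg_const 0 x)
    split_ifs with h1 h2
    · rfl
    · exact absurd (h2 ▸ hw) h1
    · rfl
  rw [killIter_succ', this, killIter_const_zero]

lemma killIter_ite_eq_of_notMem {w : Z2} (hw : w ∉ A) (k : ℕ) (x : Z2) :
    killIter A (k + 1) (fun z => if z = w then 1 else 0) x = firstHit A k x w := by
  have : killOp A (fun z => if z = w then 1 else 0) = fun x => stepProb x w := by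
    funext x
    rw [← avg_ite_eq, killOp]
    refine avg_congr fun y _ => ?_
    split_ifs with h1 h2
    · exact absurd (h2 ▸ h1) hw
    · rfl
    · rfl
    · rfl
  rw [killIter_succ', this, firstHit]

lemma sum_killIter_ite_eq_of_mem {w : Z2} (hw : w ∈ A) (n : ℕ) (x : Z2) :
    ∑ k ∈ Finset.range (n + 1), killIter A k (fun z => if z = w then 1 else 0) x =
      if x = w then 1 else 0 := by
  rw [Finset.sum_range_succ', Finset.sum_eq_zero fun k _ => killIter_ite_eq_of_mem hw k x]
  simp

/-- A Green function of the killed walk, with the visit at time 0 separated. -/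
lemma sum_killIter_ite_eq_of_notMem {w : Z2} (hw : w ∉ A) (n : ℕ) (x : Z2) :
    ∑ k ∈ Finset.range (n + 1), killIter A k (fun z => if z = w then 1 else 0) x =
      ∑ k ∈ Finset.range n, firstHit A k x w + if x = w then 1 else 0 := by
  rw [Finset.sum_range_succ', Finset.sum_congr rfl fun k _ => killIter_ite_eq_of_notMem hw k x]
  simp

/-! ### Recurrence -/

lemma killIter_one_le_one (n : ℕ) (x : Z2) : killIter A n (fun _ => 1) x ≤ 1 := by
  induction n generalizing x with
  | zero => exact le_rfl
  | succ n ih =>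
    rw [killIter_succ]
    refine (killOp_mono (g := fun _ => 1) ih x).trans ?_
    refine (avg_mono (g := fun _ => 1) fun y _ => ?_).trans (avg_const 1 x).le
    split_ifs <;> norm_num

lemma killIter_one_antitone (x : Z2) : Antitone fun n => killIter A n (fun _ => 1) x := by
  refine antitone_nat_of_succ_le fun n => ?_
  rw [killIter_succ']
  exact killIter_mono (fun y => killIter_one_le_one 1 y) n x

/-- Visits to 0 during the times 0, …, n are decomposed by the last one, at time k, after which the
walk avoids 0 for n - k steps. The case x = 0 is singled out because killing starts only at time 1.
-/
lemma last_exit_decomposition (n : ℕ) (x : Z2) :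
    (1 - if x = 0 then 0 else killIter {0} n (fun _ => 1) x) =
      ∑ k ∈ Finset.range (n + 1), walk2 k x * killIter {0} (n - k) (fun _ => 1) 0 := by
  induction n generalizing x with
  | zero =>
    simp only [walk2_zero, killIter_zero, zero_add, Finset.sum_range_one]
    split_ifs <;> norm_num
  | succ n ih =>
    have h1 : killIter {0} (n + 1) (fun _ => 1) x =
        1 - ∑ k ∈ Finset.range (n + 1), walk2 (k + 1) x * killIter {0} (n - k) (fun _ => 1) 0 := by
      have h2 : killIter {0} (n + 1) (fun _ => 1) x = avg (fun y =>
          1 - ∑ k ∈ Finset.range (n + 1), killIter {0} (n - k) (fun _ => 1) 0 * walk2 k y) x := by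
        rw [killIter_succ, killOp]
        refine avg_congr fun y _ => ?_
        rw [Finset.sum_congr rfl fun k _ => mul_comm _ _, ← ih y]
        simp
      rw [h2, avg_sub, avg_const, avg_sum]
      simp only [avg_mul_left, ← walk2_succ]
      rw [Finset.sum_congr rfl fun k _ => mul_comm _ _]
    rw [Finset.sum_range_succ']
    simp only [Nat.add_sub_add_right, Nat.sub_zero, walk2_zero]
    split_ifs with hx
    · subst hx; linarith
    · linarith

lemma tendsto_killIter_zero_one_origin :
    Tendsto (fun n => killIter {0} n (fun _ => 1) 0) atTop (𝓝 0) := by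
  have h := (tendsto_sum_walk2_center.comp (tendsto_add_atTop_nat 1)).inv_tendsto_atTop
  refine squeeze_zero (fun n => killIter_nonneg (fun _ => zero_le_one) n 0) (fun n => ?_) h
  have h1 := last_exit_decomposition n 0
  simp only [if_true, sub_zero] at h1
  have hpos : 0 < ∑ k ∈ Finset.range (n + 1), walk2 k 0 := by
    refine Finset.sum_pos' (fun k _ => walk2_nonneg k 0) ⟨0, by simp, ?_⟩
    simp [walk2_zero]
  simp only [Pi.inv_apply, Function.comp]
  -- Survival decreases in time, so the last-exit identity bounds it by the reciprocal of the
  -- expected number of visits to 0.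
  rw [inv_eq_one_div, le_div_iff₀ hpos, Finset.mul_sum]
  conv_rhs => rw [h1]
  refine Finset.sum_le_sum fun k _ => ?_
  rw [mul_comm]
  exact mul_le_mul_of_nonneg_left (killIter_one_antitone 0 (Nat.sub_le n k)) (walk2_nonneg k 0)

/-- The walk from x can step to y ≠ 0 and survive from there, so survival from y for n steps is at
most 4 times survival from x for n + 1 steps. -/
lemma tendsto_killIter_zero_one (x : Z2) :
    Tendsto (fun n => killIter {0} n (fun _ => 1) x) atTop (𝓝 0) := by
  induction x using nbrs_induction with
  | h0 => exact tendsto_killIter_zero_one_origin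
  | hs x ih y hy =>
    by_cases h0 : y = 0
    · rw [h0]; exact tendsto_killIter_zero_one_origin
    have h := ((ih.comp (tendsto_add_atTop_nat 1)).const_mul 4)
    rw [mul_zero] at h
    refine squeeze_zero (fun n => killIter_nonneg (fun _ => zero_le_one) n y) (fun n => ?_) h
    simp only [Function.comp, killIter_succ, killOp]
    refine le_trans (le_of_eq ?_) (le_four_mul_avg (fun z _ => ?_) hy)
    · simp [h0]
    · split_ifs
      · exact le_rfl
      · exact killIter_nonneg (fun _ => zero_le_one) n z

/-- Simple random walk on `ℤ²` is recurrent. -/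
lemma tendsto_killIter_one (h0 : (0 : Z2) ∈ A) (x : Z2) :
    Tendsto (fun n => killIter A n (fun _ => 1) x) atTop (𝓝 0) :=
  squeeze_zero (fun n => killIter_nonneg (fun _ => zero_le_one) n x)
    (fun n => killIter_anti (Finset.singleton_subset_iff.2 h0) (fun _ => zero_le_one) n x)
    (tendsto_killIter_zero_one x)

/-! ### Escape rates and harmonic measure -/

lemma sum_firstHit_eq (A : Finset Z2) (n : ℕ) (x : Z2) :
    ∑ z ∈ A, ∑ k ∈ Finset.range n, firstHit A k x z = 1 - killIter A n (fun _ => 1) x := by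
  have h := killIter_decomp A (f := fun _ => 1) (c := fun _ => 0)
    (fun x => by rw [avg_const, add_zero]) n x
  simp only [killIter_const_zero, Finset.sum_const_zero, one_mul] at h
  linarith

lemma summable_firstHit {z : Z2} (hz : z ∈ A) (x : Z2) :
    Summable fun k => firstHit A k x z := by
  refine summable_of_sum_range_le (c := 1) (fun k => firstHit_nonneg k x z) fun n => ?_
  refine (Finset.single_le_sum (f := fun z => ∑ k ∈ Finset.range n, firstHit A k x z)
    (fun w _ => Finset.sum_nonneg fun k _ => firstHit_nonneg k x w) hz).trans ?_
  rw [sum_firstHit_eq]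
  linarith [killIter_nonneg (A := A) (f := fun _ => 1) (fun _ => zero_le_one) n x]

/-- `hitLaw A x z = P_x[S_{τ₁(A)} = z]` for `z ∈ A`. -/
noncomputable def hitLaw (A : Finset Z2) (x z : Z2) : ℝ := ∑' k, firstHit A k x z

lemma tendsto_sum_firstHit {z : Z2} (hz : z ∈ A) (x : Z2) :
    Tendsto (fun n => ∑ k ∈ Finset.range n, firstHit A k x z) atTop (𝓝 (hitLaw A x z)) :=
  (summable_firstHit hz x).hasSum.tendsto_sum_nat

lemma tendsto_sum_mul_firstHit (f : Z2 → ℝ) (x : Z2) :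
    Tendsto (fun n => ∑ z ∈ A, f z * ∑ k ∈ Finset.range n, firstHit A k x z) atTop
      (𝓝 (∑ z ∈ A, f z * hitLaw A x z)) :=
  tendsto_finsetSum _ fun z hz => (tendsto_sum_firstHit hz x).const_mul (f z)

lemma sum_hitLaw (h0 : (0 : Z2) ∈ A) (x : Z2) : ∑ z ∈ A, hitLaw A x z = 1 := by
  have h1 := tendsto_sum_mul_firstHit (A := A) (fun _ => 1) x
  simp only [one_mul, sum_firstHit_eq] at h1
  have h2 := (tendsto_killIter_one h0 x).const_sub 1
  rw [sub_zero] at h2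
  exact tendsto_nhds_unique h1 h2

/-- The limit of `E_x[a(S_n); τ₁(A) > n]` as `n → ∞`. -/
noncomputable def escapeRate (A : Finset Z2) (x : Z2) : ℝ :=
  potentialKernel x + (if x = 0 then 1 else 0) - ∑ z ∈ A, potentialKernel z * hitLaw A x z

lemma tendsto_killIter_potentialKernel (h0 : (0 : Z2) ∈ A) (x : Z2) :
    Tendsto (fun n => killIter A n potentialKernel x) atTop (𝓝 (escapeRate A x)) := by
  -- Since 0 ∈ A, only time 0 contributes to the defect sum, which is constant once n ≥ 1.
  rw [← tendsto_add_atTop_iff_nat 1]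
  have h := (tendsto_add_atTop_iff_nat 1).2 (tendsto_sum_mul_firstHit (A := A) potentialKernel x)
  refine (h.const_sub (potentialKernel x + if x = 0 then 1 else 0)).congr fun n => ?_
  rw [killIter_decomp A avg_potentialKernel, sum_killIter_ite_eq_of_mem h0]

lemma avg_potentialKernel_sub (y x : Z2) :
    avg (fun z => potentialKernel (z - y)) x =
      potentialKernel (x - y) + if x = y then 1 else 0 := by
  have := avg_potentialKernel (x - y)
  simp only [sub_eq_zero] at this
  rw [← this]
  simp only [avg_eq, sub_add_eq_add_sub]

/-- The difference from a is bounded by C, so its killed expectation is at most C times the survival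
probability. -/
lemma tendsto_killIter_potentialKernel_sub (h0 : (0 : Z2) ∈ A) (y x : Z2) :
    Tendsto (fun n => killIter A n (fun z => potentialKernel (z - y)) x) atTop
      (𝓝 (escapeRate A x)) := by
  obtain ⟨C, hC0, hC⟩ := exists_abs_potentialKernel_sub_le (-y)
  have hd : Tendsto (fun n => killIter A n (fun z => potentialKernel (z - y)) x -
      killIter A n potentialKernel x) atTop (𝓝 0) := by
    have hb := (tendsto_killIter_one h0 x).const_mul C
    rw [mul_zero] at hb
    refine squeeze_zero_norm (fun n => ?_) hb
    have e1 := congrFun (killIter_sub A n (fun z => potentialKernel (z - y)) potentialKernel) x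
    have e2 := congrFun (killIter_mul_left A n C (fun _ => 1)) x
    have e3 := congrFun (killIter_mul_left A n (-C) (fun _ => 1)) x
    have hC' : ∀ z, |potentialKernel (z - y) - potentialKernel z| ≤ C := fun z => by
      rw [sub_eq_add_neg z y]; exact hC z
    rw [Real.norm_eq_abs, ← e1, abs_le, ← neg_mul, ← e2, ← e3]
    constructor
    · exact killIter_mono (fun z => by rw [mul_one]; exact (abs_le.1 (hC' z)).1) n x
    · exact killIter_mono (fun z => by rw [mul_one]; exact (abs_le.1 (hC' z)).2) n x
  simpa using hd.add (tendsto_killIter_potentialKernel h0 x)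

/-- Optional stopping for a(· - y) counts visits to y before the return to A, and `firstHit_comm`
reads the count as a hitting probability from y. As the hitting law from x has mass 1, a(x - y)
moves inside the sum. -/
lemma hitLaw_eq (h0 : (0 : Z2) ∈ A) {x y : Z2} (hx : x ∈ A) (hy : y ∉ A) :
    hitLaw A y x = escapeRate A x +
      ∑ z ∈ A, (potentialKernel (z - y) - potentialKernel (x - y)) * hitLaw A x z := by
  have hxy : x ≠ y := fun h => hy (h ▸ hx)
  have h1 := (tendsto_add_atTop_iff_nat 1).2 (tendsto_killIter_potentialKernel_sub h0 y x)
  have h2 := (tendsto_add_atTop_iff_nat 1).2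
    (tendsto_sum_mul_firstHit (A := A) (fun z => potentialKernel (z - y)) x)
  have h3 : Tendsto (fun n => ∑ k ∈ Finset.range n, firstHit A k y x) atTop
      (𝓝 (escapeRate A x + ∑ z ∈ A, potentialKernel (z - y) * hitLaw A x z -
        potentialKernel (x - y))) := by
    refine ((h1.add h2).sub_const (potentialKernel (x - y))).congr fun n => ?_
    rw [killIter_decomp A (avg_potentialKernel_sub y), sum_killIter_ite_eq_of_notMem hy,
      if_neg hxy]
    simp only [firstHit_comm _ y x]
    ring
  rw [tendsto_nhds_unique (tendsto_sum_firstHit hx y) h3]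
  simp only [sub_mul, Finset.sum_sub_distrib, ← Finset.mul_sum, sum_hitLaw h0]
  ring

/-- The hitting distribution converges as the starting point goes to infinity. -/
lemma tendsto_hitLaw (h0 : (0 : Z2) ∈ A) {x : Z2} (hx : x ∈ A) :
    Tendsto (fun y => hitLaw A y x) cofinite (𝓝 (escapeRate A x)) := by
  have hz : ∀ z ∈ A, Tendsto (fun y =>
      (potentialKernel (z - y) - potentialKernel (x - y)) * hitLaw A x z) cofinite (𝓝 0) := by
    intro z _
    -- The arguments differ by the fixed vector z - x while x - y leaves every finite set.
    have h := ((tendsto_potentialKernel_sub (z - x)).comp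
      (sub_right_injective (b := x)).tendsto_cofinite).mul_const (hitLaw A x z)
    rw [zero_mul] at h
    refine h.congr fun y => ?_
    simp only [Function.comp]
    rw [show x - y + (z - x) = z - y by abel]
  have h := (tendsto_finsetSum A hz).const_add (escapeRate A x)
  rw [Finset.sum_const_zero, add_zero] at h
  refine h.congr' ?_
  filter_upwards [A.finite_toSet.compl_mem_cofinite] with y hy
  exact (hitLaw_eq h0 hx (by simpa using hy)).symm

end killed

/-! ### Hitting events on path space. -/

/-- The paths that avoid `A` at the times `1, …, n`. -/
def avoid (A : Finset Z2) (n : ℕ) : Set (ℕ → Z2) := {ω | ∀ j < n, ω (j + 1) ∉ A}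

/-- The paths that avoid `A` at the times `1, …, n` and are at `z` at time `n + 1`. -/
def avoidThen (A : Finset Z2) (n : ℕ) (z : Z2) : Set (ℕ → Z2) := {ω | ω ∈ avoid A n ∧ ω (n + 1) = z}

lemma measurableSet_avoid (A : Finset Z2) (n : ℕ) : MeasurableSet (avoid A n) := by
  have : avoid A n = ⋂ j, ⋂ (_ : j < n), {ω : ℕ → Z2 | ω (j + 1) ∈ ((A : Set Z2)ᶜ)} := by
    ext ω; simp [avoid]
  rw [this]
  exact MeasurableSet.iInter fun j => MeasurableSet.iInter fun _ => measurableSet_eval _ _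

lemma measurableSet_avoidThen (A : Finset Z2) (n : ℕ) (z : Z2) :
    MeasurableSet (avoidThen A n z) :=
  (measurableSet_avoid A n).inter (measurableSet_eval (n + 1) {z})

lemma consPath_preimage_avoid (A : Finset Z2) (n : ℕ) (x : Z2) :
    consPath x ⁻¹' avoid A (n + 1) = {ω | ω 0 ∉ (A : Set Z2)} ∩ avoid A n := by
  ext ω
  simp only [avoid, Set.mem_preimage, Set.mem_ofPred_eq, Set.mem_inter_iff, consPath_succ,
    Finset.mem_coe]
  constructor
  · exact fun h => ⟨h 0 (by omega), fun j hj => h (j + 1) (by omega)⟩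
  · rintro ⟨h0, h⟩ j hj
    cases j with
    | zero => exact h0
    | succ j => exact h j (by omega)

lemma consPath_preimage_avoidThen (A : Finset Z2) (n : ℕ) (x z : Z2) :
    consPath x ⁻¹' avoidThen A (n + 1) z = {ω | ω 0 ∉ (A : Set Z2)} ∩ avoidThen A n z := by
  ext ω
  have := Set.ext_iff.1 (consPath_preimage_avoid A n x) ω
  simp only [Set.mem_preimage, Set.mem_inter_iff] at this
  simp only [avoidThen, Set.mem_preimage, Set.mem_inter_iff, Set.mem_ofPred_eq, this,
    consPath_succ, and_assoc]

lemma hitTime_eq_coe {A : Set Z2} {ω : ℕ → Z2} {k : ℕ} :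
    hitTime A ω = k ↔ (1 ≤ k ∧ ω k ∈ A) ∧ ∀ j, 1 ≤ j → j < k → ω j ∉ A := by
  have key : ∀ k : ℕ, (1 ≤ k ∧ ω k ∈ A) → (∀ j, 1 ≤ j → j < k → ω j ∉ A) → hitTime A ω = k := by
    intro k hk h
    refine le_antisymm (iInf₂_le k hk) (le_iInf₂ fun j hj => ?_)
    by_contra hlt
    exact h j hj.1 (by simpa using hlt) hj.2
  refine ⟨fun h => ?_, fun h => key k h.1 h.2⟩
  by_cases hex : ∃ m, 1 ≤ m ∧ ω m ∈ A
  · classical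
    have hm := key (Nat.find hex) (Nat.find_spec hex)
      fun j h1 hj hA => Nat.find_min hex hj ⟨h1, hA⟩
    rw [h, Nat.cast_inj] at hm
    rw [hm]
    exact ⟨Nat.find_spec hex, fun j h1 hj hA => Nat.find_min hex hj ⟨h1, hA⟩⟩
  · have : hitTime A ω = ⊤ := by
      refine iInf₂_eq_top.2 fun m hm => absurd ⟨m, hm⟩ hex
    rw [this] at h
    exact absurd h.symm (ENat.natCast_ne_top k)

lemma hitTime_eq_top {A : Set Z2} {ω : ℕ → Z2} :
    hitTime A ω = ⊤ ↔ ∀ j, ω (j + 1) ∉ A := by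
  unfold hitTime
  rw [iInf₂_eq_top]
  constructor
  · exact fun h j hj => ENat.natCast_ne_top _ (h (j + 1) ⟨by omega, hj⟩)
  · rintro h m ⟨h1, hm⟩
    obtain ⟨j, rfl⟩ := Nat.exists_eq_add_of_le' h1
    exact absurd hm (h j)

lemma setOf_hitTime_eq_top (A : Finset Z2) :
    {ω | hitTime A ω = ⊤} = ⋂ n, avoid A n := by
  ext ω
  simp only [Set.mem_ofPred_eq, hitTime_eq_top, avoid, Set.mem_iInter, Finset.mem_coe]
  exact ⟨fun h n j _ => h j, fun h j => h (j + 1) j (by omega)⟩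

lemma srw_avoidThen (A : Finset Z2) (n : ℕ) (x z : Z2) :
    (srw x).real (avoidThen A n z) = firstHit A n x z := by
  induction n generalizing x with
  | zero =>
    have e : ∀ y, consPath y ⁻¹' avoidThen A 0 z = {ω | ω 0 ∈ ({z} : Set Z2)} := by
      intro y; ext ω; simp [avoidThen, avoid]
    rw [srw_real_apply x (measurableSet_avoidThen A 0 z)]
    simp only [e, srw, chainLaw_real_start]
    rw [firstHit, killIter_zero, ← avg_ite_eq]
    simp
  | succ n ih =>
    rw [srw_real_apply x (measurableSet_avoidThen A (n + 1) z), firstHit_succ]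
    refine avg_congr fun y _ => ?_
    rw [consPath_preimage_avoidThen, srw, chainLaw_inter_start, ← ih]
    simp [srw]

lemma setOf_hit_eq {A : Finset Z2} {x : Z2} (hx : x ∈ A) :
    {ω | ∃ k : ℕ, hitTime A ω = k ∧ ω k = x} = ⋃ k, avoidThen A k x := by
  ext ω
  simp only [Set.mem_ofPred_eq, Set.mem_iUnion, avoidThen, avoid, hitTime_eq_coe, Finset.mem_coe]
  constructor
  · rintro ⟨k, ⟨⟨h1, -⟩, h⟩, hk⟩
    obtain ⟨j, rfl⟩ := Nat.exists_eq_add_of_le' h1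
    exact ⟨j, fun i hi => h (i + 1) (by omega) (by omega), hk⟩
  · rintro ⟨k, h, hk⟩
    refine ⟨k + 1, ⟨⟨by omega, hk ▸ hx⟩, fun j h1 hj => ?_⟩, hk⟩
    obtain ⟨i, rfl⟩ := Nat.exists_eq_add_of_le' h1
    exact h i (by omega)

lemma pairwise_disjoint_avoidThen {A : Finset Z2} {x : Z2} (hx : x ∈ A) :
    Pairwise (fun i j => Disjoint (avoidThen A i x) (avoidThen A j x)) := by
  have key : ∀ i j, i < j → Disjoint (avoidThen A i x) (avoidThen A j x) := by
    intro i j hij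
    rw [Set.disjoint_left]
    rintro ω ⟨-, hi⟩ ⟨hj, -⟩
    exact hj i hij (hi ▸ hx)
  intro i j hij
  rcases lt_or_gt_of_ne hij with h | h
  · exact key i j h
  · exact (key j i h).symm

lemma hitProb_eq_hitLaw {A : Finset Z2} {x : Z2} (hx : x ∈ A) (y : Z2) :
    hitProb A y x = hitLaw A y x := by
  rw [hitProb, setOf_hit_eq hx, measureReal_def,
    measure_iUnion (pairwise_disjoint_avoidThen hx) fun k => measurableSet_avoidThen A k x,
    ENNReal.tsum_toReal_eq fun k => measure_ne_top _ _, hitLaw]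
  exact tsum_congr fun k => srw_avoidThen A k y x

lemma hitProb_eq_zero {A : Finset Z2} {x : Z2} (hx : x ∉ A) (y : Z2) : hitProb A y x = 0 := by
  have : {ω | ∃ k : ℕ, hitTime A ω = k ∧ ω k = x} = ∅ := by
    ext ω
    simp only [Set.mem_ofPred_eq, Set.mem_empty_iff_false, iff_false]
    rintro ⟨k, h, hk⟩
    exact hx (hk ▸ (hitTime_eq_coe.1 h).1.2)
  rw [hitProb, this, measureReal_empty]

lemma cobounded_eq_cofinite : Bornology.cobounded Z2 = cofinite := by
  rw [Metric.cobounded_eq_cocompact, cocompact_eq_cofinite]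

lemma tendsto_hitProb {A : Finset Z2} (h0 : (0 : Z2) ∈ A) (x : Z2) :
    Tendsto (fun y => hitProb A y x) (Bornology.cobounded Z2)
      (𝓝 (if x ∈ A then escapeRate A x else 0)) := by
  rw [cobounded_eq_cofinite]
  split_ifs with hx
  · simp only [hitProb_eq_hitLaw hx]; exact tendsto_hitLaw h0 hx
  · simp only [hitProb_eq_zero hx]; exact tendsto_const_nhds

lemma harmonicMeasure_eq {A : Finset Z2} (h0 : (0 : Z2) ∈ A) (x : Z2) :
    harmonicMeasure A x = if x ∈ A then escapeRate A x else 0 := by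
  have : (Bornology.cobounded Z2).NeBot := by rw [cobounded_eq_cofinite]; infer_instance
  exact (tendsto_hitProb h0 x).limUnder_eq

/-! ### The conditioned walk -/

lemma sum_hatStep_weights {x : Z2} (hx : x ≠ 0) :
    ∑ y ∈ nbrs x, ENNReal.ofReal (potentialKernel y / (4 * potentialKernel x)) = 1 := by
  have hpos := potentialKernel_pos hx
  rw [← ENNReal.ofReal_sum_of_nonneg fun y _ =>
    div_nonneg (potentialKernel_nonneg y) (by positivity), ← Finset.sum_div]
  have h := avg_potentialKernel x
  rw [if_neg hx, add_zero, avg, div_eq_iff (by norm_num)] at h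
  rw [h, mul_comm, div_self (by positivity), ENNReal.ofReal_one]

lemma hatStep_apply {x : Z2} (hx : x ≠ 0) (y : Z2) :
    hatStep x y = if y ∈ nbrs x then
      ENNReal.ofReal (potentialKernel y / (4 * potentialKernel x)) else 0 := by
  classical
  rw [hatStep, dif_pos (sum_hatStep_weights hx), PMF.ofFinset_apply]

lemma hatStep_toReal {x y : Z2} (hx : x ≠ 0) (hy : y ∈ nbrs x) :
    (hatStep x y).toReal = potentialKernel y / (4 * potentialKernel x) := by
  rw [hatStep_apply hx, if_pos hy, ENNReal.toReal_ofReal]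
  exact div_nonneg (potentialKernel_nonneg y) (by linarith [potentialKernel_nonneg x])

lemma hatStep_zero_right {x : Z2} (hx : x ≠ 0) : hatStep x 0 = 0 := by
  rw [hatStep_apply hx]; simp

instance (x : Z2) : IsProbabilityMeasure (hatWalk x) := by unfold hatWalk; infer_instance

/-- The factor a(x) cancels the denominator of the transition probability and leaves the averaging
recursion of simple random walk. -/
lemma potentialKernel_mul_hatWalk_real {x : Z2} (hx : x ≠ 0) {E : Set (ℕ → Z2)}
    (hE : MeasurableSet E) :
    potentialKernel x * (hatWalk x).real E =
      avg (fun y => potentialKernel y * (hatWalk y).real (consPath x ⁻¹' E)) x := by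
  have hpos := potentialKernel_pos hx
  unfold hatWalk
  rw [chainLaw_real_apply _ x hE (s := nbrs x), avg, Finset.sum_div, Finset.mul_sum]
  · refine Finset.sum_congr rfl fun y hy => ?_
    rw [hatStep_toReal hx hy]
    field_simp
  · exact fun y hy => by rw [hatStep_apply hx, if_neg hy]

/-- Since 0 ∈ A, surviving steps never lead to the origin, so the recursion is used only where the
h-transform is defined. -/
lemma potentialKernel_mul_hatWalk_avoid {A : Finset Z2} (h0 : (0 : Z2) ∈ A) (n : ℕ) {x : Z2}
    (hx : x ≠ 0) :
    potentialKernel x * (hatWalk x).real (avoid A n) = killIter A n potentialKernel x := by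
  induction n generalizing x with
  | zero =>
    have : avoid A 0 = Set.univ := by ext; simp [avoid]
    simp [this]
  | succ n ih =>
    rw [potentialKernel_mul_hatWalk_real hx (measurableSet_avoid A (n + 1)), killIter_succ, killOp]
    refine avg_congr fun y _ => ?_
    rw [consPath_preimage_avoid, hatWalk, chainLaw_inter_start]
    by_cases hy : y ∈ A
    · simp [hy]
    · simp only [Finset.mem_coe, hy, if_false]
      exact ih fun h => hy (h ▸ h0)

lemma avoid_antitone (A : Finset Z2) : Antitone (avoid A) :=
  fun _ _ hmn _ h j hj => h j (hj.trans_le hmn)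

lemma potentialKernel_mul_hatWalk_hitTime {A : Finset Z2} (h0 : (0 : Z2) ∈ A) {x : Z2}
    (hx : x ≠ 0) :
    potentialKernel x * (hatWalk x).real {ω | hitTime A ω = ⊤} = escapeRate A x := by
  have h1 : Tendsto (fun n => (hatWalk x).real (avoid A n)) atTop
      (𝓝 ((hatWalk x).real {ω | hitTime A ω = ⊤})) := by
    rw [setOf_hitTime_eq_top]
    exact (ENNReal.tendsto_toReal (measure_ne_top _ _)).comp (tendsto_measure_iInter_atTop
      (fun n => (measurableSet_avoid A n).nullMeasurableSet) (avoid_antitone A)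
      ⟨0, measure_ne_top _ _⟩)
  refine tendsto_nhds_unique (h1.const_mul _) ?_
  simp only [potentialKernel_mul_hatWalk_avoid h0 _ hx]
  exact tendsto_killIter_potentialKernel h0 x

theorem capacity_eq_hatCapacity {A : Finset Z2} (h0 : (0 : Z2) ∈ A) :
    capacity A = hatCapacity A := by
  refine Finset.sum_congr rfl fun x hx => ?_
  rw [harmonicMeasure_eq h0, if_pos hx, hatEquilibrium, if_pos hx]
  by_cases h : x = 0
  -- a(0) = 0 annihilates both terms, whatever the harmonic measure of the origin.
  · simp [h]
  · rw [← potentialKernel_mul_hatWalk_hitTime h0 h]; ring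

/-! ### Transience of the conditioned walk -/

lemma potentialKernel_mul_hatWalk_eval (n : ℕ) {x : Z2} (hx : x ≠ 0) (z : Z2) :
    potentialKernel x * (hatWalk x).real {ω | ω n = z} =
      potentialKernel z * killIter {0} n (fun w => if w = z then 1 else 0) x := by
  have key : ∀ f : Z2 → ℝ, killIter {0} n (fun w => potentialKernel z * f w) =
      fun x => potentialKernel z * killIter {0} n f x := killIter_mul_left {0} n _
  refine Eq.trans ?_ (congrFun (key fun w => if w = z then 1 else 0) x)
  clear key
  induction n generalizing x with
  | zero =>
    have := chainLaw_real_start hatStep x {z}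
    simp only [Set.mem_singleton_iff] at this
    rw [hatWalk, this, killIter_zero]
    split_ifs with h
    · rw [h]
    · simp
  | succ n ih =>
    rw [potentialKernel_mul_hatWalk_real hx (E := {ω | ω (n + 1) = z})
      (measurableSet_eval (n + 1) {z}), killIter_succ, killOp]
    refine avg_congr fun y _ => ?_
    by_cases hy : y = 0
    · simp [hy]
    · rw [if_neg (by simpa using hy)]
      exact ih hy

/-- The Green function of the walk killed at 0 is finite: optional stopping for a(· - z) writes its
partial sums through convergent quantities. -/
lemma summable_killIter_ite_eq (x z : Z2) :
    Summable fun n => killIter {0} n (fun w => if w = z then 1 else 0) x := by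
  have hn : ∀ n, 0 ≤ killIter {0} n (fun w => if w = z then 1 else 0) x := fun n =>
    killIter_nonneg (fun w => by split_ifs <;> norm_num) n x
  have h0 : (0 : Z2) ∈ ({0} : Finset Z2) := Finset.mem_singleton_self 0
  have h1 := (tendsto_killIter_potentialKernel_sub h0 z x).sub_const (potentialKernel (x - z))
  have h2 := tendsto_sum_mul_firstHit (A := {0}) (fun w => potentialKernel (w - z)) x
  refine (((hasSum_iff_tendsto_nat_of_nonneg hn _).2 ((h1.add h2).congr fun n => ?_))).summable
  rw [killIter_decomp {0} (avg_potentialKernel_sub z)]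
  ring

/-- Borel–Cantelli, with the Green function of the conditioned walk as an h-transform of the killed
one. -/
lemma hatWalk_transient {x : Z2} (hx : x ≠ 0) :
    ∀ᵐ ω ∂hatWalk x, ∀ z, {n | ω n = z}.Finite := by
  rw [ae_all_iff]
  intro z
  have hs : Summable fun n => (hatWalk x).real {ω | ω n = z} := by
    have h := ((summable_killIter_ite_eq x z).mul_left (potentialKernel z)).mul_left
      (potentialKernel x)⁻¹
    refine h.congr fun n => ?_
    rw [← potentialKernel_mul_hatWalk_eval n hx, inv_mul_cancel_left₀ (potentialKernel_pos hx).ne']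
  have hne : ∑' n, hatWalk x {ω | ω n = z} ≠ ∞ := by
    have := hs.tsum_ofReal_ne_top
    simpa [measureReal_def] using this
  filter_upwards [ae_eventually_notMem hne] with ω hω
  rw [← Nat.cofinite_eq_atTop] at hω
  simpa [Filter.eventually_cofinite] using hω

lemma hatWalk_nbrs {x : Z2} (hx : x ≠ 0) :
    ∀ᵐ ω ∂hatWalk x, ∀ n, ω (n + 1) ∈ nbrs (ω n) := by
  have hm : ∀ n, MeasurableSet {ω : ℕ → Z2 | ω (n + 1) ∉ nbrs (ω n)} := fun n => by
    have : Measurable fun ω : ℕ → Z2 => (ω (n + 1), ω n) := by fun_prop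
    exact this (MeasurableSet.of_discrete (s := {q : Z2 × Z2 | q.1 ∉ nbrs q.2}))
  rw [ae_all_iff]
  intro n
  rw [ae_iff]
  induction n generalizing x with
  | zero =>
    rw [hatWalk, chainLaw_apply _ _ (hm 0), ENNReal.tsum_eq_zero]
    intro y
    by_cases hy : y ∈ nbrs x
    · refine mul_eq_zero_of_right _ ?_
      refine measure_mono_null (fun ω hω => ?_) (ae_iff.1 (chainLaw_zero_ae hatStep y))
      intro h
      simp only [Set.mem_preimage, Set.mem_ofPred_eq, consPath_succ, consPath_zero] at hω
      exact hω (h ▸ hy)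
    · rw [hatStep_apply hx, if_neg hy, zero_mul]
  | succ n ih =>
    rw [hatWalk, chainLaw_apply _ _ (hm (n + 1)), ENNReal.tsum_eq_zero]
    intro y
    by_cases hy : y = 0
    · rw [hy, hatStep_zero_right hx, zero_mul]
    · exact mul_eq_zero_of_right _ (ih hy)

/-! ### The stationary doubly infinite conditioned walk. -/

/-- The law of the stationary doubly infinite conditioned walk, an infinite measure. -/
noncomputable def biLaw : Measure (ℤ → Z2) :=
  Measure.sum fun x => ENNReal.ofReal (potentialKernel x ^ 2) •
    ((hatWalk x).prod (hatWalk x)).map glue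

/-- Time shift of a doubly infinite path. -/
def shiftPath (n : ℤ) (ϱ : ℤ → Z2) (k : ℤ) : Z2 := ϱ (k + n)

lemma measurable_shiftPath (n : ℤ) : Measurable (shiftPath n) :=
  measurable_pi_lambda _ fun k => measurable_pi_apply (k + n)

lemma biLaw_apply {E : Set (ℤ → Z2)} (hE : MeasurableSet E) :
    biLaw E = ∑' x, ENNReal.ofReal (potentialKernel x ^ 2) *
      ((hatWalk x).prod (hatWalk x)) (glue ⁻¹' E) := by
  rw [biLaw, Measure.sum_apply _ hE]
  simp_rw [Measure.smul_apply, Measure.map_apply measurable_glue hE, smul_eq_mul]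

lemma hatWalk_prod_apply_left (x : Z2) (μ : Measure (ℕ → Z2)) [SFinite μ]
    {E : Set ((ℕ → Z2) × (ℕ → Z2))} (hE : MeasurableSet E) :
    ((hatWalk x).prod μ) E =
      ∑' y, hatStep x y * ((hatWalk y).prod μ) (Prod.map (consPath x) id ⁻¹' E) := by
  have hm : Measurable (Prod.map (consPath x) (id : (ℕ → Z2) → ℕ → Z2)) :=
    (measurable_consPath x).prodMap measurable_id
  have h : ∀ y, ((hatWalk y).map (consPath x)).prod μ =
      ((hatWalk y).prod μ).map (Prod.map (consPath x) id) := fun y => by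
    rw [← Measure.map_prod_map _ _ (measurable_consPath x) measurable_id, Measure.map_id]
  conv_lhs => rw [hatWalk, chainLaw_eq_sum, Measure.prod_sum_left, Measure.sum_apply _ hE]
  refine tsum_congr fun y => ?_
  rw [Measure.prod_smul_left, Measure.smul_apply, smul_eq_mul, ← Measure.map_apply hm hE, ← h]
  rfl

lemma hatWalk_prod_apply_right (x : Z2) (μ : Measure (ℕ → Z2)) [SFinite μ]
    {E : Set ((ℕ → Z2) × (ℕ → Z2))} (hE : MeasurableSet E) :
    (μ.prod (hatWalk x)) E =
      ∑' y, hatStep x y * (μ.prod (hatWalk y)) (Prod.map id (consPath x) ⁻¹' E) := by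
  have hm : Measurable (Prod.map (id : (ℕ → Z2) → ℕ → Z2) (consPath x)) :=
    measurable_id.prodMap (measurable_consPath x)
  have h : ∀ y, μ.prod ((hatWalk y).map (consPath x)) =
      (μ.prod (hatWalk y)).map (Prod.map id (consPath x)) := fun y => by
    rw [← Measure.map_prod_map _ _ measurable_id (measurable_consPath x), Measure.map_id]
  have hs : ∀ y, SFinite (hatStep x y • (chainLaw hatStep y).map (consPath x)) :=
    fun y => inferInstance
  conv_lhs => rw [hatWalk, chainLaw_eq_sum, Measure.prod_sum_right, Measure.sum_apply _ hE]
  refine tsum_congr fun y => ?_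
  rw [Measure.prod_smul_right, Measure.smul_apply, smul_eq_mul, ← Measure.map_apply hm hE, ← h]
  rfl

/-- Away from the origin both sides are a(x)a(y)/4 on neighbours. The placeholder step at 0 does no
harm: its weight is a(0)² = 0, and no other site steps to 0. -/
lemma hatStep_reversible (x y : Z2) :
    ENNReal.ofReal (potentialKernel x ^ 2) * hatStep x y =
      ENNReal.ofReal (potentialKernel y ^ 2) * hatStep y x := by
  have h0 : ∀ y, ENNReal.ofReal (potentialKernel 0 ^ 2) * hatStep 0 y =
      ENNReal.ofReal (potentialKernel y ^ 2) * hatStep y 0 := by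
    intro y
    by_cases hy : y = 0
    · rw [hy]
    · rw [hatStep_zero_right hy]; simp
  by_cases hx : x = 0
  · rw [hx, h0]
  by_cases hy : y = 0
  · rw [hy, h0]
  have px := potentialKernel_pos hx
  have py := potentialKernel_pos hy
  rw [hatStep_apply hx, hatStep_apply hy]
  by_cases h : y ∈ nbrs x
  · rw [if_pos h, if_pos (mem_nbrs_comm.1 h), ← ENNReal.ofReal_mul (by positivity),
      ← ENNReal.ofReal_mul (by positivity)]
    congr 1
    field_simp
  · rw [if_neg h, if_neg fun h' => h (mem_nbrs_comm.1 h')]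
    simp

/-- The old origin x moves to time -1. The site y is arbitrary because `glue` never reads the
backward path at time 0. -/
lemma shiftPath_glue_consPath {x y : Z2} {ω ω' : ℕ → Z2} (h : ω' 0 = x) :
    shiftPath 1 (glue (consPath x ω, ω')) = glue (ω, consPath y ω') := by
  funext k
  simp only [shiftPath, glue]
  by_cases hk : 0 ≤ k
  · rw [if_pos (by omega), if_pos hk]
    obtain ⟨n, rfl⟩ := Int.eq_ofNat_of_zero_le hk
    rw [show ((n : ℤ) + 1).toNat = n + 1 by omega]
    simp
  · rw [if_neg hk]
    obtain ⟨n, hn⟩ : ∃ n : ℕ, k = -((n : ℤ) + 1) := ⟨(-k - 1).toNat, by omega⟩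
    subst hn
    rw [show (-(-((n : ℤ) + 1))).toNat = n + 1 by omega]
    cases n with
    | zero => simp [h]
    | succ n =>
      rw [if_neg (by omega),
        show (-(-(((n + 1 : ℕ) : ℤ) + 1) + 1)).toNat = n + 1 by omega]
      simp

/-- Reversibility of the conditioned walk makes its doubly infinite law invariant under shift. -/
lemma biLaw_shift {E : Set (ℤ → Z2)} (hE : MeasurableSet E) :
    biLaw (shiftPath 1 ⁻¹' E) = biLaw E := by
  have hE' := measurable_shiftPath 1 hE
  rw [biLaw_apply hE', biLaw_apply hE]
  -- One side peels off the forward step from x to y, the other the backward step from y to x;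
  -- reversibility matches their weights.
  have h1 := fun x => hatWalk_prod_apply_left x (hatWalk x) (measurable_glue hE')
  have h2 := fun x => hatWalk_prod_apply_right x (hatWalk x) (measurable_glue hE)
  simp_rw [h1, h2, ← ENNReal.tsum_mul_left]
  rw [ENNReal.tsum_comm]
  refine tsum_congr fun y => tsum_congr fun x => ?_
  rw [← mul_assoc, ← mul_assoc, hatStep_reversible]
  congr 1
  refine measure_congr ?_
  have h : ∀ᵐ q ∂(hatWalk y).prod (hatWalk x), q.2 0 = x :=
    Measure.quasiMeasurePreserving_snd.ae (chainLaw_zero_ae hatStep x)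
  filter_upwards [h] with q hq
  simp only [eq_iff_iff]
  change shiftPath 1 (glue (consPath x q.1, q.2)) ∈ E ↔ glue (q.1, consPath y q.2) ∈ E
  rw [shiftPath_glue_consPath hq]

/-- The paths whose first visit to `A` takes place at time `n`. -/
def entersAt (A : Finset Z2) (n : ℤ) : Set (ℤ → Z2) := {ϱ | ϱ n ∈ A ∧ ∀ m < n, ϱ m ∉ A}

lemma measurableSet_entersAt (A : Finset Z2) (n : ℤ) : MeasurableSet (entersAt A n) := by
  have : entersAt A n = ((fun ϱ : ℤ → Z2 => ϱ n) ⁻¹' (A : Set Z2)) ∩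
      ⋂ m, ⋂ (_ : m < n), (fun ϱ : ℤ → Z2 => ϱ m) ⁻¹' (A : Set Z2)ᶜ := by
    ext ϱ; simp [entersAt]
  rw [this]
  exact (measurable_pi_apply n MeasurableSet.of_discrete).inter
    (MeasurableSet.iInter fun m => MeasurableSet.iInter fun _ =>
      measurable_pi_apply m MeasurableSet.of_discrete)

lemma shiftPath_preimage_entersAt (A : Finset Z2) (n m : ℤ) :
    shiftPath n ⁻¹' entersAt A m = entersAt A (m + n) := by
  ext ϱ
  simp only [entersAt, shiftPath, Set.mem_preimage, Set.mem_ofPred_eq]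
  refine and_congr_right fun _ => ⟨fun h k hk => ?_, fun h k hk => h _ (by omega)⟩
  have := h (k - n) (by omega)
  rwa [sub_add_cancel] at this

lemma glue_mem_entersAt {A : Finset Z2} {q : (ℕ → Z2) × (ℕ → Z2)} :
    glue q ∈ entersAt A 0 ↔ q.1 0 ∈ A ∧ hitTime A q.2 = ⊤ := by
  simp only [entersAt, Set.mem_ofPred_eq, hitTime_eq_top, Finset.mem_coe, glue]
  refine and_congr (by simp) ⟨fun h j => ?_, fun h m hm => ?_⟩
  · have := h (-((j : ℤ) + 1)) (by omega)
    rw [if_neg (by omega), show (-(-((j : ℤ) + 1))).toNat = j + 1 by omega] at this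
    exact this
  · rw [if_neg (by omega), show (-m).toNat = (-m - 1).toNat + 1 by omega]
    exact h _

/-- The escape probability in the equilibrium weight cancels the normalisation of the conditional
law; if it is 0, both sides vanish. -/
lemma ofReal_hatEquilibrium_smul_cond {A : Finset Z2} {x : Z2} (hx : x ∈ A) :
    ENNReal.ofReal (hatEquilibrium A x) • ProbabilityTheory.cond (hatWalk x)
        {ω | hitTime A ω = ⊤} =
      ENNReal.ofReal (potentialKernel x ^ 2) • (hatWalk x).restrict {ω | hitTime A ω = ⊤} := by
  rw [hatEquilibrium, if_pos hx, ProbabilityTheory.cond]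
  by_cases h : hatWalk x {ω | hitTime A ω = ⊤} = 0
  · rw [Measure.restrict_eq_zero.2 h]; simp
  · rw [smul_smul, ENNReal.ofReal_mul measureReal_nonneg, ofReal_measureReal, mul_comm,
      ← mul_assoc, ENNReal.inv_mul_cancel h (measure_ne_top _ _), one_mul]

/-- A first visit to A at time 0 means starting in A with a backward path that avoids A. All Q_A
thus come from one shift-invariant measure. -/
lemma pathQ_eq_restrict (A : Finset Z2) : pathQ A = biLaw.restrict (entersAt A 0) := by
  ext E hE
  rw [Measure.restrict_apply hE, biLaw_apply (hE.inter (measurableSet_entersAt A 0)),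
    tsum_eq_sum (s := A), pathQ, Measure.finsetSum_apply]
  · refine Finset.sum_congr rfl fun x hx => ?_
    rw [← Measure.map_smul, ← Measure.prod_smul_right, ofReal_hatEquilibrium_smul_cond hx,
      Measure.prod_smul_right, Measure.map_smul, Measure.smul_apply, smul_eq_mul,
      Measure.map_apply measurable_glue hE]
    congr 1
    have h1 : (hatWalk x).prod ((hatWalk x).restrict {ω | hitTime A ω = ⊤}) =
        ((hatWalk x).prod (hatWalk x)).restrict (Set.univ ×ˢ {ω | hitTime A ω = ⊤}) := by
      rw [← Measure.prod_restrict, Measure.restrict_univ]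
    rw [h1, Measure.restrict_apply (measurable_glue hE)]
    refine measure_congr ?_
    have h : ∀ᵐ q ∂(hatWalk x).prod (hatWalk x), q.1 0 = x :=
      Measure.quasiMeasurePreserving_fst.ae (chainLaw_zero_ae hatStep x)
    filter_upwards [h] with q hq
    simp only [eq_iff_iff]
    change (glue q ∈ E ∧ q ∈ Set.univ ×ˢ {ω | hitTime A ω = ⊤}) ↔
      (glue q ∈ E ∧ glue q ∈ entersAt A 0)
    rw [glue_mem_entersAt, hq]
    simp [hx]
  · intro x hx
    refine mul_eq_zero_of_right _ ?_
    refine measure_mono_null (t := {q | ¬q.1 0 = x}) ?_ ?_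
    · rintro q ⟨-, hq⟩ h
      rw [glue_mem_entersAt, h] at hq
      exact hx hq.1
    · exact ae_iff.1 (Measure.quasiMeasurePreserving_fst.ae (chainLaw_zero_ae hatStep x))

/-! ### Time shifts and consistency of the measures Q_A. -/

lemma shiftPath_mem_trajSet {n : ℤ} {ϱ : ℤ → Z2} (h : ϱ ∈ trajSet) : shiftPath n ϱ ∈ trajSet := by
  refine ⟨fun k => ?_, fun y => ?_⟩
  · have := h.1 (k + n)
    rwa [show k + n + 1 = k + 1 + n by ring] at this
  · exact (h.2 y).preimage (add_left_injective n).injOn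

lemma shiftPath_shiftPath (m n : ℤ) (ϱ : ℤ → Z2) :
    shiftPath m (shiftPath n ϱ) = shiftPath (m + n) ϱ := by
  funext k; simp only [shiftPath, add_assoc]

@[simp] lemma shiftPath_zero (ϱ : ℤ → Z2) : shiftPath 0 ϱ = ϱ := by
  funext k; simp [shiftPath]

/-- Time shift on the space of trajectories. -/
def shiftW (n : ℤ) (ϱ : W) : W := ⟨shiftPath n ϱ.1, shiftPath_mem_trajSet ϱ.2⟩

lemma measurable_shiftW (n : ℤ) : Measurable (shiftW n) :=
  ((measurable_shiftPath n).comp measurable_subtype_coe).subtype_mk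

lemma proj_shiftW (n : ℤ) (ϱ : W) : proj (shiftW n ϱ) = proj ϱ :=
  Quotient.sound (s := shiftSetoid) (Setoid.symm' shiftSetoid ⟨n, fun _ => rfl⟩)

lemma measurableEmbedding_val : MeasurableEmbedding (Subtype.val : W → ℤ → Z2) :=
  MeasurableEmbedding.subtype_coe measurableSet_trajSet

/-- The stationary doubly infinite conditioned walk on the space of trajectories. -/
noncomputable def wLaw : Measure W := biLaw.comap Subtype.val

lemma wLaw_apply (F : Set W) : wLaw F = biLaw (Subtype.val '' F) :=
  measurableEmbedding_val.comap_apply _ _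

lemma wLaw_shiftW_one {F : Set W} (hF : MeasurableSet F) : wLaw (shiftW 1 ⁻¹' F) = wLaw F := by
  have : (Subtype.val '' (shiftW 1 ⁻¹' F) : Set (ℤ → Z2)) =
      shiftPath 1 ⁻¹' (Subtype.val '' F) := by
    ext ϱ
    constructor
    · rintro ⟨ϱ', h, rfl⟩
      exact ⟨_, h, rfl⟩
    · rintro ⟨ϱ', h, h'⟩
      have hϱ : shiftPath (-1) ϱ'.1 = ϱ := by rw [h', shiftPath_shiftPath]; simp
      have hmem : ϱ ∈ trajSet := hϱ ▸ shiftPath_mem_trajSet ϱ'.2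
      refine ⟨⟨ϱ, hmem⟩, ?_, rfl⟩
      rwa [Set.mem_preimage, show shiftW 1 ⟨ϱ, hmem⟩ = ϱ' from Subtype.ext h'.symm]
  rw [wLaw_apply, wLaw_apply, this,
    biLaw_shift (measurableEmbedding_val.measurableSet_image.2 hF)]

lemma shiftW_preimage_preimage (m n : ℤ) (F : Set W) :
    shiftW m ⁻¹' (shiftW n ⁻¹' F) = shiftW (n + m) ⁻¹' F := by
  ext ϱ
  have : shiftW n (shiftW m ϱ) = shiftW (n + m) ϱ := Subtype.ext (shiftPath_shiftPath n m ϱ.1)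
  simp only [Set.mem_preimage, this]

lemma shiftW_zero_preimage (F : Set W) : shiftW 0 ⁻¹' F = F := by
  ext ϱ
  have : shiftW 0 ϱ = ϱ := Subtype.ext (shiftPath_zero ϱ.1)
  rw [Set.mem_preimage, this]

lemma wLaw_shiftW (n : ℤ) {F : Set W} (hF : MeasurableSet F) : wLaw (shiftW n ⁻¹' F) = wLaw F := by
  have hnat : ∀ (k : ℕ) {F : Set W}, MeasurableSet F → wLaw (shiftW k ⁻¹' F) = wLaw F := by
    intro k
    induction k with
    | zero => intro F _; rw [Nat.cast_zero, shiftW_zero_preimage]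
    | succ k ih =>
      intro F hF
      rw [Nat.cast_succ, ← shiftW_preimage_preimage, wLaw_shiftW_one (measurable_shiftW k hF),
        ih hF]
  rcases Int.eq_nat_or_neg n with ⟨k, rfl | rfl⟩
  · exact hnat k hF
  · rw [← hnat k (measurable_shiftW _ hF), shiftW_preimage_preimage, neg_add_cancel,
      shiftW_zero_preimage]

/-- The trajectories whose first visit to `A` takes place at time `n`. -/
def entersAtW (A : Finset Z2) (n : ℤ) : Set W := Subtype.val ⁻¹' entersAt A n

/-- The trajectories that intersect `A`. -/
def throughW (A : Finset Z2) : Set W := {ϱ | ∃ k, ϱ.1 k ∈ A}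

lemma measurableSet_entersAtW (A : Finset Z2) (n : ℤ) : MeasurableSet (entersAtW A n) :=
  measurable_subtype_coe (measurableSet_entersAt A n)

lemma throughW_eq_iUnion (A : Finset Z2) : throughW A = ⋃ n, entersAtW A n := by
  ext ϱ
  simp only [throughW, entersAtW, entersAt, Set.mem_ofPred_eq, Set.mem_iUnion, Set.mem_preimage]
  refine ⟨fun ⟨k, hk⟩ => ?_, fun ⟨n, h, _⟩ => ⟨n, h⟩⟩
  -- Finitely many visits to each site of the finite set A guarantee a first one.
  have hfin : {m | ϱ.1 m ∈ A}.Finite := by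
    have : {m | ϱ.1 m ∈ A} = ⋃ y ∈ A, {m | ϱ.1 m = y} := by ext; simp
    rw [this]
    exact A.finite_toSet.biUnion fun y _ => ϱ.2.2 y
  obtain ⟨n, hn, hmin⟩ := hfin.exists_minimalFor id _ ⟨k, hk⟩
  refine ⟨n, hn, fun m hm hA => ?_⟩
  have := hmin hA hm.le
  simp only [id] at this
  omega

lemma measurableSet_throughW (A : Finset Z2) : MeasurableSet (throughW A) := by
  rw [throughW_eq_iUnion]
  exact MeasurableSet.iUnion fun n => measurableSet_entersAtW A n

lemma pairwise_disjoint_entersAtW (A : Finset Z2) :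
    Pairwise (fun m n => Disjoint (entersAtW A m) (entersAtW A n)) := by
  have key : ∀ m n, m < n → Disjoint (entersAtW A m) (entersAtW A n) := fun m n hmn =>
    Set.disjoint_left.2 fun ϱ hm hn => hn.2 m hmn hm.1
  intro m n hmn
  rcases lt_or_gt_of_ne hmn with h | h
  · exact key m n h
  · exact (key n m h).symm

lemma shiftW_preimage_entersAtW (A : Finset Z2) (n m : ℤ) :
    shiftW n ⁻¹' entersAtW A m = entersAtW A (m + n) := by
  unfold entersAtW
  rw [← shiftPath_preimage_entersAt]
  rfl

lemma measureQ_eq_restrict (A : Finset Z2) : measureQ A = wLaw.restrict (entersAtW A 0) := by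
  ext F hF
  rw [Measure.restrict_apply hF, wLaw_apply, measureQ, measurableEmbedding_val.comap_apply,
    pathQ_eq_restrict,
    Measure.restrict_apply (measurableEmbedding_val.measurableSet_image.2 hF), entersAtW,
    Set.image_inter_preimage]

/-- The measures `Q_A` are consistent on sets of trajectories that are invariant under shift. -/
lemma measureQ_inter_throughW_comm (A B : Finset Z2) {F : Set W} (hF : MeasurableSet F)
    (hinv : ∀ n, shiftW n ⁻¹' F = F) :
    measureQ A (F ∩ throughW B) = measureQ B (F ∩ throughW A) := by
  have expand : ∀ A B : Finset Z2, measureQ A (F ∩ throughW B) =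
      ∑' n : ℤ, wLaw (F ∩ entersAtW B n ∩ entersAtW A 0) := by
    intro A B
    rw [measureQ_eq_restrict, Measure.restrict_apply (hF.inter (measurableSet_throughW B)),
      throughW_eq_iUnion, Set.inter_iUnion, Set.iUnion_inter, measure_iUnion]
    · intro m n hmn
      exact ((pairwise_disjoint_entersAtW B hmn).mono Set.inter_subset_right
        Set.inter_subset_right).mono Set.inter_subset_left Set.inter_subset_left
    · exact fun n => (hF.inter (measurableSet_entersAtW B n)).inter (measurableSet_entersAtW A 0)
  -- Shifting by n turns entrance to B at -n and to A at 0 into entrance to B at 0 and to A at n.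
  rw [expand, expand, ← (Equiv.neg ℤ).tsum_eq]
  refine tsum_congr fun n => ?_
  rw [← wLaw_shiftW n ((hF.inter (measurableSet_entersAtW B _)).inter
    (measurableSet_entersAtW A 0)), Set.preimage_inter, Set.preimage_inter, hinv,
    shiftW_preimage_entersAtW, shiftW_preimage_entersAtW, Equiv.neg_apply, neg_add_cancel,
    zero_add, Set.inter_right_comm]

/-! ### Total mass -/

lemma glue_mem_trajSet {x : Z2} {q : (ℕ → Z2) × (ℕ → Z2)} (h1 : q.1 0 = x) (h2 : q.2 0 = x)
    (n1 : ∀ n, q.1 (n + 1) ∈ nbrs (q.1 n)) (n2 : ∀ n, q.2 (n + 1) ∈ nbrs (q.2 n))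
    (f1 : ∀ z, {n | q.1 n = z}.Finite) (f2 : ∀ z, {n | q.2 n = z}.Finite) :
    glue q ∈ trajSet := by
  have hneg : ∀ n : ℕ, glue q (-(n : ℤ)) = q.2 n := by
    intro n
    cases n with
    | zero => simp [glue, h1, h2]
    | succ n =>
      rw [glue, if_neg (by push_cast; omega)]
      congr 1
  refine ⟨fun k => ?_, fun y => ?_⟩
  · by_cases hk : 0 ≤ k
    · obtain ⟨n, rfl⟩ := Int.eq_ofNat_of_zero_le hk
      simp only [glue]
      rw [if_pos (by omega), if_pos (by omega)]
      exact n1 n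
    · obtain ⟨n, rfl⟩ : ∃ n : ℕ, k = -((n + 1 : ℕ) : ℤ) := ⟨(-k - 1).toNat, by omega⟩
      rw [show -((n + 1 : ℕ) : ℤ) + 1 = -(n : ℤ) by push_cast; ring, hneg, hneg]
      exact mem_nbrs_comm.1 (n2 n)
  · refine (((f1 y).image fun n : ℕ => (n : ℤ)).union
      ((f2 y).image fun n : ℕ => -(n : ℤ))).subset fun m hm => ?_
    by_cases h : 0 ≤ m
    · obtain ⟨n, rfl⟩ := Int.eq_ofNat_of_zero_le h
      refine Or.inl ⟨n, ?_, rfl⟩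
      simpa [glue] using hm
    · obtain ⟨n, rfl⟩ : ∃ n : ℕ, m = -(n : ℤ) := ⟨(-m).toNat, by omega⟩
      exact Or.inr ⟨n, (hneg n).symm.trans hm, rfl⟩

lemma hatEquilibrium_zero (A : Finset Z2) : hatEquilibrium A 0 = 0 := by
  simp [hatEquilibrium]

lemma hatEquilibrium_nonneg (A : Finset Z2) (x : Z2) : 0 ≤ hatEquilibrium A x := by
  unfold hatEquilibrium
  split_ifs
  · positivity
  · exact le_rfl

/-- `measureQ` would lose any mass outside W; transience and nearest-neighbour steps show that there
is none. -/
lemma pathQ_compl_trajSet (A : Finset Z2) : pathQ A trajSetᶜ = 0 := by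
  rw [pathQ, Measure.finsetSum_apply]
  refine Finset.sum_eq_zero fun x _ => ?_
  by_cases hx : x = 0
  · rw [hx, hatEquilibrium_zero]; simp
  rw [Measure.smul_apply, Measure.map_apply measurable_glue measurableSet_trajSet.compl]
  refine smul_eq_zero_of_right _ ?_
  have hgood : ∀ᵐ ω ∂hatWalk x, ω 0 = x ∧ (∀ n, ω (n + 1) ∈ nbrs (ω n)) ∧
      ∀ z, {n | ω n = z}.Finite := by
    filter_upwards [chainLaw_zero_ae hatStep x, hatWalk_nbrs hx, hatWalk_transient hx]
      with ω h1 h2 h3 using ⟨h1, h2, h3⟩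
  have g1 := Measure.quasiMeasurePreserving_fst (μ := hatWalk x)
    (ν := ProbabilityTheory.cond (hatWalk x) {ω | hitTime A ω = ⊤}) |>.ae hgood
  have g2 := Measure.quasiMeasurePreserving_snd (μ := hatWalk x)
    (ν := ProbabilityTheory.cond (hatWalk x) {ω | hitTime A ω = ⊤}) |>.ae
      (cond_absolutelyContinuous.ae_le hgood)
  have : ∀ᵐ q ∂(hatWalk x).prod (ProbabilityTheory.cond (hatWalk x) {ω | hitTime A ω = ⊤}),
      glue q ∈ trajSet := by
    filter_upwards [g1, g2] with q h1 h2
    exact glue_mem_trajSet h1.1 h2.1 h1.2.1 h2.2.1 h1.2.2 h2.2.2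
  exact ae_iff.1 this

lemma pathQ_univ (A : Finset Z2) : pathQ A Set.univ = ENNReal.ofReal (hatCapacity A) := by
  rw [pathQ, Measure.finsetSum_apply, hatCapacity,
    ENNReal.ofReal_sum_of_nonneg fun x _ => hatEquilibrium_nonneg A x]
  refine Finset.sum_congr rfl fun x hx => ?_
  rw [Measure.smul_apply, Measure.map_apply measurable_glue MeasurableSet.univ, smul_eq_mul,
    Set.preimage_univ, ← Set.univ_prod_univ, Measure.prod_prod]
  by_cases h : hatWalk x {ω | hitTime A ω = ⊤} = 0
  · rw [hatEquilibrium, if_pos hx, measureReal_def, h]; simp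
  · have := cond_isProbabilityMeasure h
    simp

lemma measureQ_univ (A : Finset Z2) : measureQ A Set.univ = ENNReal.ofReal (hatCapacity A) := by
  rw [measureQ, measurableEmbedding_val.comap_apply, Set.image_univ, Subtype.range_coe_subtype,
    ← pathQ_univ]
  exact measure_congr (ae_eq_univ.2 (pathQ_compl_trajSet A))

/-! ### The intensity measure -/

lemma measurable_proj : Measurable proj := measurable_quotient_mk'

lemma measurableSet_wstar {G : Set WStar} (h : MeasurableSet (proj ⁻¹' G)) : MeasurableSet G :=
  measurableSet_quotient.2 h

lemma proj_preimage_starThrough (A : Finset Z2) :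
    proj ⁻¹' starThrough (A : Set Z2) = throughW A := by
  ext ϱ
  constructor
  · rintro ⟨ϱ', ⟨k, hk⟩, h⟩
    obtain ⟨n, hn⟩ : shiftSetoid ϱ' ϱ := Quotient.exact h
    refine ⟨k - n, ?_⟩
    rw [hn, sub_add_cancel]
    exact hk
  · exact fun h => ⟨ϱ, h, rfl⟩

lemma measurableSet_starThrough (A : Finset Z2) : MeasurableSet (starThrough (A : Set Z2)) :=
  measurableSet_wstar (by rw [proj_preimage_starThrough]; exact measurableSet_throughW A)

lemma starThrough_eq_biUnion (A : Set Z2) : starThrough A = ⋃ x ∈ A, starThrough {x} := by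
  ext w
  simp only [starThrough, Set.mem_image, Set.mem_ofPred_eq, Set.mem_iUnion, Set.mem_singleton_iff]
  constructor
  · rintro ⟨ϱ, ⟨k, hk⟩, rfl⟩
    exact ⟨_, hk, ϱ, ⟨k, rfl⟩, rfl⟩
  · rintro ⟨x, hx, ϱ, ⟨k, hk⟩, rfl⟩
    exact ⟨ϱ, ⟨k, hk ▸ hx⟩, rfl⟩

lemma iUnion_starThrough_singleton :
    ⋃ x : Z2, starThrough (({x} : Finset Z2) : Set Z2) = Set.univ := by
  ext w
  induction w using Quotient.inductionOn with
  | h ϱ => simpa using ⟨(ϱ.1 0).1, (ϱ.1 0).2, ϱ, ⟨0, rfl⟩, rfl⟩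

lemma IsIntensity.unique {ν ν' : Measure WStar} (h : IsIntensity ν) (h' : IsIntensity ν') :
    ν = ν' :=
  (Measure.ext_iff_of_iUnion_eq_univ iUnion_starThrough_singleton).2 fun x => by
    rw [h.restrict_eq, h'.restrict_eq]

lemma measureQ_map_proj_inter_comm (A B : Finset Z2) {G : Set WStar} (hG : MeasurableSet G) :
    (measureQ A).map proj (G ∩ starThrough (B : Set Z2)) =
      (measureQ B).map proj (G ∩ starThrough (A : Set Z2)) := by
  rw [Measure.map_apply measurable_proj (hG.inter (measurableSet_starThrough B)),
    Measure.map_apply measurable_proj (hG.inter (measurableSet_starThrough A)),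
    Set.preimage_inter, Set.preimage_inter, proj_preimage_starThrough, proj_preimage_starThrough]
  refine measureQ_inter_throughW_comm A B (measurable_proj hG) fun n => ?_
  ext ϱ
  simp only [Set.mem_preimage, proj_shiftW]

/-- W* is partitioned by the first site, in an enumeration of the lattice, that a trajectory visits;
each piece receives the image of the Q of that site. -/
theorem exists_isIntensity : ∃ ν : Measure WStar, IsIntensity ν := by
  obtain ⟨e, he⟩ := exists_surjective_nat Z2
  set S : ℕ → Set WStar := fun n => starThrough (({e n} : Finset Z2) : Set Z2) with hS
  have hSm : ∀ n, MeasurableSet (S n) := fun n => measurableSet_starThrough _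
  have hDm : ∀ n, MeasurableSet (disjointed S n) := MeasurableSet.disjointed hSm
  have hDu : ⋃ n, disjointed S n = Set.univ := by
    rw [iUnion_disjointed, ← iUnion_starThrough_singleton]
    exact he.iUnion_comp fun x => starThrough (({x} : Finset Z2) : Set Z2)
  set ν : Measure WStar := Measure.sum fun n =>
    ((measureQ {e n}).map proj).restrict (disjointed S n) with hν
  have hres : ∀ A : Finset Z2, ν.restrict (starThrough A) = (measureQ A).map proj := by
    intro A
    ext G hG
    have hterm : ∀ n, ((measureQ {e n}).map proj).restrict (disjointed S n)
        (G ∩ starThrough (A : Set Z2)) = (measureQ A).map proj (G ∩ disjointed S n) := by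
      intro n
      have hGD := hG.inter (hDm n)
      -- Consistency exchanges A with the site e n; passing through e n is then automatic on the
      -- n-th piece.
      rw [Measure.restrict_apply (hG.inter (measurableSet_starThrough A)), Set.inter_right_comm,
        measureQ_map_proj_inter_comm _ _ hGD]
      congr 1
      exact Set.inter_eq_left.2 (Set.inter_subset_right.trans (disjointed_subset S n))
    rw [Measure.restrict_apply hG, hν,
      Measure.sum_apply _ (hG.inter (measurableSet_starThrough A)), tsum_congr hterm,
      ← measure_iUnion, ← Set.inter_iUnion, hDu, Set.inter_univ]
    · exact fun m n hmn => (disjoint_disjointed S hmn).mono Set.inter_subset_right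
        Set.inter_subset_right
    · exact fun n => hG.inter (hDm n)
  refine ⟨ν, ?_, hres⟩
  refine Measure.sigmaFinite_of_countable
    (S := Set.range fun x : Z2 => starThrough (({x} : Finset Z2) : Set Z2))
    (Set.countable_range _) ?_ ?_
  · rintro _ ⟨x, rfl⟩
    simp only
    rw [← Measure.restrict_apply_univ, hres,
      Measure.map_apply measurable_proj MeasurableSet.univ, Set.preimage_univ, measureQ_univ]
    exact ENNReal.ofReal_lt_top
  · rw [Set.sUnion_range]
    exact iUnion_starThrough_singleton

lemma IsIntensity.starThrough_eq {ν : Measure WStar} (h : IsIntensity ν) (A : Finset Z2) :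
    ν (starThrough (A : Set Z2)) = ENNReal.ofReal (hatCapacity A) := by
  rw [← Measure.restrict_apply_univ, h.restrict_eq,
    Measure.map_apply measurable_proj MeasurableSet.univ, Set.preimage_univ, measureQ_univ]

lemma hatCapacity_nonneg (A : Finset Z2) : 0 ≤ hatCapacity A :=
  Finset.sum_nonneg fun x _ => hatEquilibrium_nonneg A x

/-! ### The vacant set -/

/-- A being vacant is a single void event: the finitely many conditions, one per site, are a finite
union of null sets. -/
lemma subset_vacantSet_iff (A : Finset Z2) (α : ℝ) (c : Measure (WStar × ℝ)) :
    (A : Set Z2) ⊆ vacantSet α c ↔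
      c (starThrough (A : Set Z2) ×ˢ Set.Iic (Real.pi * α)) = 0 := by
  have hx : ∀ x, interlacement α c (starThrough {x}) =
      c (starThrough {x} ×ˢ Set.Iic (Real.pi * α)) := by
    intro x
    have hm : MeasurableSet (starThrough {x}) := by
      simpa using measurableSet_starThrough {x}
    rw [interlacement, Measure.map_apply measurable_fst hm,
      Measure.restrict_apply (measurable_fst hm)]
    rfl
  rw [starThrough_eq_biUnion, Set.iUnion₂_prod_const,
    measure_biUnion_null_iff A.finite_toSet.countable]
  simp only [← hx]
  rfl

lemma poisson_void_probability {Ω E : Type*} [MeasurableSpace Ω] [MeasurableSpace E]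
    {Λ : Measure E} {P : Measure Ω} {η : Ω → Measure E} (h : IsPoissonPointProcess Λ P η)
    {B : Set E} (hB : MeasurableSet B) (hΛ : Λ B ≠ ∞) :
    P.real {ω | η ω B = 0} = Real.exp (-(Λ B).toReal) := by
  have hm : Measurable fun ω => η ω B := (Measure.measurable_coe hB).comp h.measurable
  have hp := congrArg (fun μ => μ {(0 : ℝ≥0∞)}) (h.poisson B hB hΛ)
  rw [Measure.map_apply hm (measurableSet_singleton 0),
    Measure.map_apply (measurable_of_countable _) (measurableSet_singleton 0)] at hp
  have e1 : (fun ω => η ω B) ⁻¹' {(0 : ℝ≥0∞)} = {ω | η ω B = 0} := rfl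
  have e2 : (fun n : ℕ => (n : ℝ≥0∞)) ⁻¹' {(0 : ℝ≥0∞)} = {0} := by ext; simp
  rw [e1, e2] at hp
  rw [measureReal_def, hp, ← measureReal_def, poissonMeasure_real_singleton]
  simp only [pow_zero, mul_one, Nat.factorial_zero, Nat.cast_one, div_one]
  rfl

theorem vacantSet_probability {A : Finset Z2} (h0 : (0 : Z2) ∈ A) {ν : Measure WStar}
    (hν : IsIntensity ν) {Ω : Type*} [MeasurableSpace Ω] {P : Measure Ω}
    {η : Ω → Measure (WStar × ℝ)}
    (hη : IsPoissonPointProcess (ν.prod (volume.restrict (Set.Ici (0 : ℝ)))) P η)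
    {α : ℝ} (hα : 0 < α) :
    P.real {ω | (A : Set Z2) ⊆ vacantSet α (η ω)} = Real.exp (-Real.pi * α * capacity A) := by
  have := hν.sigmaFinite
  have hpos : 0 < Real.pi * α := mul_pos Real.pi_pos hα
  have hΛ : (ν.prod (volume.restrict (Set.Ici (0 : ℝ))))
      (starThrough (A : Set Z2) ×ˢ Set.Iic (Real.pi * α)) =
        ENNReal.ofReal (hatCapacity A * (Real.pi * α)) := by
    rw [Measure.prod_prod, hν.starThrough_eq, Measure.restrict_apply measurableSet_Iic,
      Set.Iic_inter_Ici, Real.volume_Icc, sub_zero, ENNReal.ofReal_mul (hatCapacity_nonneg A)]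
  simp only [subset_vacantSet_iff]
  rw [poisson_void_probability hη ((measurableSet_starThrough A).prod measurableSet_Iic)
    (by rw [hΛ]; exact ENNReal.ofReal_ne_top), hΛ,
    ENNReal.toReal_ofReal (mul_nonneg (hatCapacity_nonneg A) hpos.le), capacity_eq_hatCapacity h0]
  congr 1
  ring

end RI2D

theorem proposition2p2 :
    -- the potential kernel and the conditioned walk are well defined
    (∀ x : RI2D.Z2,
      Tendsto (RI2D.potentialPartialSum x) atTop (𝓝 (RI2D.potentialKernel x))) ∧
    (∀ x : RI2D.Z2, x ≠ 0 → 0 < RI2D.potentialKernel x) ∧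
    (∀ x : RI2D.Z2, x ≠ 0 → ∀ y ∈ RI2D.nbrs x,
      (RI2D.hatStep x y).toReal = RI2D.potentialKernel y / (4 * RI2D.potentialKernel x)) ∧
    -- the trajectory intensity of the interlacement exists and is unique
    (∃! ν : Measure RI2D.WStar, RI2D.IsIntensity ν) ∧
    ∀ A : Finset RI2D.Z2, (0 : RI2D.Z2) ∈ A →
      -- the harmonic measure of `A` is well defined
      (∀ x : RI2D.Z2, Tendsto (fun y => RI2D.hitProb A y x) (Bornology.cobounded RI2D.Z2)
        (𝓝 (RI2D.harmonicMeasure A x))) ∧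
      RI2D.capacity A = RI2D.hatCapacity A ∧
      ∀ (ν : Measure RI2D.WStar), RI2D.IsIntensity ν →
      ∀ (Ω : Type*) [MeasurableSpace Ω] (P : Measure Ω) [IsProbabilityMeasure P]
        (η : Ω → Measure (RI2D.WStar × ℝ)),
        RI2D.IsPoissonPointProcess (ν.prod (volume.restrict (Set.Ici (0 : ℝ)))) P η →
        ∀ α : ℝ, 0 < α →
          P.real {ω | (A : Set RI2D.Z2) ⊆ RI2D.vacantSet α (η ω)} =
            Real.exp (-Real.pi * α * RI2D.capacity A) := by
  refine ⟨RI2D.tendsto_potentialPartialSum, fun x hx => RI2D.potentialKernel_pos hx,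
    fun x hx y hy => RI2D.hatStep_toReal hx hy, ?_, fun A h0 => ⟨fun x => ?_,
    RI2D.capacity_eq_hatCapacity h0, fun ν hν Ω _ P _ η hη α hα =>
    RI2D.vacantSet_probability h0 hν hη hα⟩⟩
  · obtain ⟨ν, hν⟩ := RI2D.exists_isIntensity
    exact ⟨ν, hν, fun ν' hν' => hν'.unique hν⟩
  · rw [RI2D.harmonicMeasure_eq h0]
    exact RI2D.tendsto_hitProb h0 x
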